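/- Let $\Phi:\mathbb{C}[x]\to[0,\infty)$ be a multiplicative distance function, that is, $\Phi$ is continuous in the coefficients on every finite dimensional subspace of $\mathbb{C}[x]$, and for all $f,g\in\mathbb{C}[x]$ and $w\in\mathbb{C}$: $\Phi(f)=0$ if and only if $f=0$; $\Phi(wf)=|w|\Phi(f)$; and $\Phi(fg)=\Phi(f)\Phi(g)$. Let $\phi(\gamma)=\Phi(x-\gamma)$, $\gamma\in\mathbb{C}$, be its root function. Let $N\ge 0$ be an integer, let $s\in\mathbb{C}$ with $\operatorname{Re}(s)>N$, let $J=\lfloor (N+1)/2\rfloor$, and let $\mathbf{P}=\{P_1,\dots,P_N\}\subset\mathbb{C}[\gamma]$ be any complete family of monic polynomials, i.e. $P_n$ is monic of degree $n-1$ for $n=1,\dots,N$. Put $$F_N(\Phi;s)=\int_{\mathbb{R}^N}\widetilde\Phi(\mathbf b)^{-s}\,d\lambda_N(\mathbf b),\qquad \widetilde\Phi(\mathbf b)=\Phi\Big(x^N+\sum_{n=1}^N b_n x^{N-n}\Big),$$ and, for polynomials $P,Q$, put $\langle P,Q\rangle=\langle P,Q\rangle_{\mathbb R}+\langle P,Q\rangle_{\mathbb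 C}$ with $$\langle P,Q\rangle_{\mathbb R}=\int_{\mathbb{R}^2}\phi(x)^{-s}\phi(y)^{-s}P(x)Q(y)\,\mathrm{sgn}(y-x)\,dx\,dy,$$ $$\langle P,Q\rangle_{\mathbb C}=-2i\int_{\mathbb{C}}\phi(\beta)^{-s}\phi(\overline\beta)^{-s}P(\overline\beta)Q(\beta)\,\mathrm{sgn}(\operatorname{Im}\beta)\,d\lambda_2(\beta),$$ where $\lambda_N$ and $\lambda_2$ are Lebesgue measure on $\mathbb{R}^N$ and on $\mathbb{C}$. Let $U_{\mathbf P}$ be the $2J\times 2J$ matrix with entries $$U_{\mathbf P}[j,k]=\begin{cases}\langle P_j,P_k\rangle & \text{if } j,k\le N,\\ \mathrm{sgn}(k-j)\int_{\mathbb R}\phi(x)^{-s}P_{\min\{j,k\}}(x)\,dx & \text{otherwise,}\end{cases}$$ where for $N$ odd the entry $U_{\mathbf P}[N+1,N+1]$ is $0$. Then the integral defining $F_N(\Phi;s)$ and the integrals $\langle P_j,P_k\rangle_{\mathbb R}$, $\langle P_j,P_k\rangle_{\mathbb C}$ and $\int_{\mathbb R}\phi(x)^{-s}P_j(x)\,dx$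 $(1\le j,k\le N)$ converge absolutely, $U_{\mathbf P}$ is antisymmetric, and $$F_N(\Phi;s)=\operatorname{Pf}U_{\mathbf P},\qquad\text{where}\quad \operatorname{Pf}U=\frac{1}{2^J J!}\sum_{\tau\in S_{2J}}\mathrm{sgn}(\tau)\prod_{j=1}^J U[\tau(2j-1),\tau(2j)].$$ -/

import Mathlib

open MeasureTheory Polynomial

noncomputable section

/-- A multiplicative distance function `Φ : ℂ[x] → [0, ∞)`: continuous in the coefficient vector on
the space of polynomials of degree `< d` for every `d` (every finite dimensional subspace of `ℂ[x]`
lies in one of these), positive definite, absolutely homogeneous and multiplicative. -/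
structure IsMultiplicativeDistance (Φ : ℂ[X] → ℝ) : Prop where
  nonneg : ∀ f, 0 ≤ Φ f
  continuous_coeff : ∀ d : ℕ, Continuous fun c : Fin d → ℂ => Φ (∑ i, C (c i) * X ^ (i : ℕ))
  eq_zero_iff : ∀ f, Φ f = 0 ↔ f = 0
  map_smul : ∀ (w : ℂ) (f : ℂ[X]), Φ (w • f) = ‖w‖ * Φ f
  map_mul : ∀ f g, Φ (f * g) = Φ f * Φ g

/-- The root function `φ(γ) = Φ(x - γ)`. -/
def rootFunction (Φ : ℂ[X] → ℝ) (γ : ℂ) : ℝ := Φ (X - C γ)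

/-- The degree `N` monic restriction `Φ̃(b) = Φ(x^N + ∑_{n=1}^N b_n x^{N-n})`; the coordinate `b_n`
has the index `n - 1` in `Fin N`. -/
def monicRestriction (Φ : ℂ[X] → ℝ) (N : ℕ) (b : Fin N → ℂ) : ℝ :=
  Φ (X ^ N + ∑ i : Fin N, C (b i) * X ^ (N - ((i : ℕ) + 1)))

/-- The integrand `b ↦ Φ̃(b)^{-s}` of the real moment function. -/
def momentIntegrand (Φ : ℂ[X] → ℝ) (N : ℕ) (s : ℂ) (b : Fin N → ℝ) : ℂ :=
  (monicRestriction Φ N (fun i => (b i : ℂ)) : ℂ) ^ (-s)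

/-- The real degree `N` moment function `F_N(Φ; s) = ∫_{ℝ^N} Φ̃(b)^{-s} db`. -/
def realMoment (Φ : ℂ[X] → ℝ) (N : ℕ) (s : ℂ) : ℂ :=
  ∫ b : Fin N → ℝ, momentIntegrand Φ N s b

/-- `φ(γ)^{-s}`. -/
def rootWeight (Φ : ℂ[X] → ℝ) (s γ : ℂ) : ℂ := (rootFunction Φ γ : ℂ) ^ (-s)

/-- The integrand of `⟨P, Q⟩_ℝ`. -/
def realFormIntegrand (Φ : ℂ[X] → ℝ) (s : ℂ) (P Q : ℂ[X]) (z : ℝ × ℝ) : ℂ :=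
  rootWeight Φ s z.1 * rootWeight Φ s z.2 * P.eval (z.1 : ℂ) * Q.eval (z.2 : ℂ) *
    (Real.sign (z.2 - z.1) : ℂ)

/-- `⟨P, Q⟩_ℝ = ∫_{ℝ²} φ(x)^{-s} φ(y)^{-s} P(x) Q(y) sgn(y - x) dx dy`. -/
def realForm (Φ : ℂ[X] → ℝ) (s : ℂ) (P Q : ℂ[X]) : ℂ :=
  ∫ z : ℝ × ℝ, realFormIntegrand Φ s P Q z

/-- The integrand of `⟨P, Q⟩_ℂ`, without the factor `-2i`. -/
def complexFormIntegrand (Φ : ℂ[X] → ℝ) (s : ℂ) (P Q : ℂ[X]) (β : ℂ) : ℂ :=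
  rootWeight Φ s β * rootWeight Φ s (starRingEnd ℂ β) * P.eval (starRingEnd ℂ β) * Q.eval β *
    (Real.sign β.im : ℂ)

/-- `⟨P, Q⟩_ℂ = -2i ∫_ℂ φ(β)^{-s} φ(β̄)^{-s} P(β̄) Q(β) sgn(Im β) dλ₂(β)`. -/
def complexForm (Φ : ℂ[X] → ℝ) (s : ℂ) (P Q : ℂ[X]) : ℂ :=
  -2 * Complex.I * ∫ β : ℂ, complexFormIntegrand Φ s P Q β

/-- `⟨P, Q⟩ = ⟨P, Q⟩_ℝ + ⟨P, Q⟩_ℂ`. -/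
def skewForm (Φ : ℂ[X] → ℝ) (s : ℂ) (P Q : ℂ[X]) : ℂ :=
  realForm Φ s P Q + complexForm Φ s P Q

/-- The integrand of the border entry `∫_ℝ φ(x)^{-s} P(x) dx`. -/
def borderIntegrand (Φ : ℂ[X] → ℝ) (s : ℂ) (P : ℂ[X]) (x : ℝ) : ℂ :=
  rootWeight Φ s x * P.eval (x : ℂ)

/-- A complete family of monic polynomials: `P_1, …, P_N` monic with `deg P_n = n - 1`; `P_n` has
the index `n - 1` in `Fin N`. -/
def IsCompleteMonicFamily {N : ℕ} (P : Fin N → ℂ[X]) : Prop :=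
  ∀ j, (P j).Monic ∧ (P j).natDegree = (j : ℕ)

/-- The `2J × 2J` matrix `U_P`, where `J` is the integer part of `(N + 1) / 2`, with indices from
`0`. Its entries are `⟨P_j, P_k⟩` where both polynomials exist and
`sgn(k - j) ∫_ℝ φ(x)^{-s} P_{min(j,k)}(x) dx` otherwise. The last branch is the corner `j = k = N`
for odd `N`: there `P_{min(j,k)}` does not exist and `sgn(k - j) = 0`. -/
def skewMatrix (Φ : ℂ[X] → ℝ) (s : ℂ) {N : ℕ} (P : Fin N → ℂ[X]) :
    Matrix (Fin (2 * ((N + 1) / 2))) (Fin (2 * ((N + 1) / 2))) ℂ :=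
  Matrix.of fun j k =>
    if h : (j : ℕ) < N ∧ (k : ℕ) < N then
      skewForm Φ s (P ⟨j, h.1⟩) (P ⟨k, h.2⟩)
    else if h' : min (j : ℕ) (k : ℕ) < N then
      ((SignType.sign ((k : ℤ) - (j : ℤ)) : ℤ) : ℂ) *
        ∫ x : ℝ, borderIntegrand Φ s (P ⟨min (j : ℕ) (k : ℕ), h'⟩) x
    else 0

/-- The Pfaffian of a `2J × 2J` (antisymmetric) matrix,
`(1 / (2^J J!)) ∑_{τ ∈ S_{2J}} sgn(τ) ∏_{j=1}^J U[τ(2j-1), τ(2j)]`. -/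
def pfaffian {J : ℕ} (U : Matrix (Fin (2 * J)) (Fin (2 * J)) ℂ) : ℂ :=
  1 / (2 ^ J * (J.factorial : ℂ)) *
    ∑ τ : Equiv.Perm (Fin (2 * J)), ((Equiv.Perm.sign τ : ℤ) : ℂ) *
      ∏ j : Fin J, U (τ ⟨2 * (j : ℕ), by omega⟩) (τ ⟨2 * (j : ℕ) + 1, by omega⟩)

end

/-!
For points `z₁, …, z_m` let `M_n(z)` be the integral of `Φ(f)^{-s} f(z₁) ⋯ f(z_m)` over the real
monic polynomials `f` of degree `n`, so that `M_N()` is the moment to be computed. Write `f` of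
degree `n + 2` as `f = q g` with `q` a real monic quadratic, parametrized either by two real roots
or by the real and imaginary part of a root. The Jacobian of multiplication is the resultant of `q`
and `g`, which is `g(α) g(β)` if `α, β` are the roots of `q`. Counted with the sign of `g(α) g(β)`,
a squarefree `f` arises exactly `2 ⌊(n + 2) / 2⌋` times: each nonreal root counts once, and since
the signs of `f'` alternate along the real roots, the ordered pairs of real roots contribute the
number of real roots minus its parity. The area formula therefore expresses `M_{n+2}(z)` through the
integrals of `M_n(z, α, β)` over real pairs and over conjugate pairs `(α, β)`.

The weight `|α - β|` of the parametrization turns the Vandermonde determinant `Δ(z)` into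
`Δ(z, α, β)` up to a sign, which is the sign in the skew forms. Iterating down to degree `0` or `1`
and expanding `Δ` as `det (P_k (z_i))` integrates the variables in pairs, and each pair gives a
factor `⟨P_j, P_k⟩`. For odd `N` the last variable is alone and gives the border entry; since the
summands of the Pfaffian do not depend on the position of an index, this matches its expansion along
the last column.
-/

noncomputable section

section AreaFormula

open Function Set
open scoped ENNReal NNReal

theorem encard_iUnion_inter_preimage_singleton {α β ι : Type*} {f : α → β} {t : ι → Set α}
    (hdisj : Pairwise (Disjoint on t)) (hinj : ∀ i, InjOn f (t i)) (y : β) :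
    ((⋃ i, t i) ∩ f ⁻¹' {y}).encard = {i | y ∈ f '' t i}.encard := by
  choose x hxt hxy using fun i : {i | y ∈ f '' t i} => i.2
  have hx : Injective x := fun i j hij => by
    by_contra hne
    exact (hdisj (Subtype.coe_injective.ne hne)).ne_of_mem (hxt i) (hxt j) hij
  have hrange : range x = (⋃ i, t i) ∩ f ⁻¹' {y} := by
    refine Subset.antisymm (range_subset_iff.2 fun i => ⟨mem_iUnion_of_mem _ (hxt i), hxy i⟩) ?_
    rintro z ⟨hz, hzy⟩
    obtain ⟨i, hi⟩ := mem_iUnion.1 hz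
    have hmem : i ∈ {i | y ∈ f '' t i} := ⟨z, hi, hzy⟩
    exact ⟨⟨i, hmem⟩, hinj i (hxt ⟨i, hmem⟩) hi ((hxy ⟨i, hmem⟩).trans hzy.symm)⟩
  rw [← hrange, ← image_univ, hx.encard_image, encard_univ]
  rfl

theorem toENNReal_encard_iUnion_inter_preimage_singleton {α β ι : Type*} {f : α → β}
    {t : ι → Set α} (hdisj : Pairwise (Disjoint on t)) (hinj : ∀ i, InjOn f (t i)) (y : β) :
    (((⋃ i, t i) ∩ f ⁻¹' {y}).encard : ℝ≥0∞) =
      ∑' i, (f '' t i).indicator (fun _ => (1 : ℝ≥0∞)) y := by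
  rw [encard_iUnion_inter_preimage_singleton hdisj hinj, ← ENNReal.tsum_set_one,
    tsum_subtype {i | y ∈ f '' t i} fun _ => (1 : ℝ≥0∞)]
  rfl

theorem exists_approximatesLinearOn_imp_injOn {E : Type*} [NormedAddCommGroup E] [NormedSpace ℝ E]
    [FiniteDimensional ℝ E] {A : E →L[ℝ] E} (hA : A.det ≠ 0) :
    ∃ c : ℝ≥0, c ≠ 0 ∧ ∀ (f : E → E) (s : Set E), ApproximatesLinearOn f A s c → InjOn f s := by
  obtain ⟨e, rfl⟩ : ∃ e : E ≃L[ℝ] E, (e : E →L[ℝ] E) = A :=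
    ⟨A.toContinuousLinearEquivOfDetNeZero hA, A.coe_toContinuousLinearEquivOfDetNeZero hA⟩
  rcases subsingleton_or_nontrivial E with hE | hE
  · exact ⟨1, one_ne_zero, fun f s h => h.injOn (Or.inl hE)⟩
  · have hpos : 0 < ‖(e.symm : E →L[ℝ] E)‖₊⁻¹ := inv_pos.2 e.nnnorm_symm_pos
    exact ⟨‖(e.symm : E →L[ℝ] E)‖₊⁻¹ / 2, (half_pos hpos).ne',
      fun f s h => h.injOn (Or.inr (half_lt_self hpos))⟩

theorem toReal_toENNReal_encard {α : Type*} (t : Set α) :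
    ((t.encard : ℝ≥0∞)).toReal = t.ncard := by
  rw [ncard]
  cases t.encard <;> simp

theorem ae_toENNReal_encard_le {α β : Type*} [MeasurableSpace α] {ν : Measure α} {t : α → Set β}
    {K : ℕ} (hK : ∀ᵐ y ∂ν, (t y).encard ≤ K) : ∀ᵐ y ∂ν, ((t y).encard : ℝ≥0∞) ≤ K :=
  hK.mono fun y hy => by simpa using ENat.toENNReal_mono hy

theorem ae_toENNReal_encard_lt_top {α β : Type*} [MeasurableSpace α] {ν : Measure α}
    {t : α → Set β} {K : ℕ} (hK : ∀ᵐ y ∂ν, (t y).encard ≤ K) :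
    ∀ᵐ y ∂ν, ((t y).encard : ℝ≥0∞) < ∞ :=
  (ae_toENNReal_encard_le hK).mono fun _ hy => hy.trans_lt (ENNReal.natCast_lt_top K)

theorem integrable_withDensity_encard {α β F : Type*} [MeasurableSpace α] {ν : Measure α}
    [NormedAddCommGroup F] {h : α → F} {t : α → Set β} {K : ℕ}
    (hK : ∀ᵐ y ∂ν, (t y).encard ≤ K) (hh : Integrable h ν) :
    Integrable h (ν.withDensity fun y => ((t y).encard : ℝ≥0∞)) := by
  refine (hh.smul_measure (ENNReal.natCast_ne_top K)).mono_measure ?_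
  rw [← withDensity_const]
  exact withDensity_mono (ae_toENNReal_encard_le hK)

variable {E : Type*} [NormedAddCommGroup E] [NormedSpace ℝ E] [FiniteDimensional ℝ E]
  [MeasurableSpace E] [BorelSpace E] {f : E → E} {f' : E → E →L[ℝ] E} {s : Set E}

theorem exists_measurable_partition_injOn (hs : MeasurableSet s)
    (hf' : ∀ x ∈ s, HasFDerivWithinAt f (f' x) s x) (hdet : ∀ x ∈ s, (f' x).det ≠ 0) :
    ∃ t : ℕ → Set E, Pairwise (Disjoint on t) ∧ (∀ n, MeasurableSet (t n)) ∧
      (∀ n, InjOn f (t n)) ∧ ⋃ n, t n = s := by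
  rcases s.eq_empty_or_nonempty with rfl | hne
  · exact ⟨fun _ => ∅, fun _ _ _ => disjoint_bot_left, fun _ => .empty, fun _ => injOn_empty f,
      iUnion_empty⟩
  have hr : ∀ A : E →L[ℝ] E, ∃ c : ℝ≥0, c ≠ 0 ∧
      (A.det ≠ 0 → ∀ (f : E → E) (s : Set E), ApproximatesLinearOn f A s c → InjOn f s) := by
    intro A
    by_cases hA : A.det = 0
    · exact ⟨1, one_ne_zero, fun h => absurd hA h⟩
    · obtain ⟨c, hc, hinj⟩ := exists_approximatesLinearOn_imp_injOn hA
      exact ⟨c, hc, fun _ => hinj⟩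
  choose r hr_ne hr_inj using hr
  obtain ⟨t, A, hdisj, ht, hst, happrox, hA⟩ :=
    exists_partition_approximatesLinearOn_of_hasFDerivWithinAt f s f' hf' r hr_ne
  refine ⟨fun n => s ∩ t n, fun i j hij => (hdisj hij).mono inter_subset_right inter_subset_right,
    fun n => hs.inter (ht n), fun n => ?_, by rw [← inter_iUnion, inter_eq_left.2 hst]⟩
  obtain ⟨x, hx, hAx⟩ := hA hne n
  exact hr_inj (A n) (hAx ▸ hdet x hx) f _ (happrox n)

theorem measurable_encard_inter_preimage_singleton (hs : MeasurableSet s)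
    (hf' : ∀ x ∈ s, HasFDerivWithinAt f (f' x) s x) (hdet : ∀ x ∈ s, (f' x).det ≠ 0) :
    Measurable fun y => ((s ∩ f ⁻¹' {y}).encard : ℝ≥0∞) := by
  obtain ⟨t, hdisj, ht, hinj, rfl⟩ := exists_measurable_partition_injOn hs hf' hdet
  simp_rw [toENNReal_encard_iUnion_inter_preimage_singleton hdisj hinj]
  exact .tsum fun n => measurable_const.indicator <| measurable_image_of_fderivWithin (ht n)
    (fun x hx => (hf' x (mem_iUnion_of_mem n hx)).mono (subset_iUnion t n)) (hinj n)

theorem integrable_ncard_smul {F : Type*} [NormedAddCommGroup F] [NormedSpace ℝ F] {μ : Measure E}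
    {h : E → F} (hs : MeasurableSet s)
    (hf' : ∀ x ∈ s, HasFDerivWithinAt f (f' x) s x) (hdet : ∀ x ∈ s, (f' x).det ≠ 0) {K : ℕ}
    (hK : ∀ᵐ y ∂μ, (s ∩ f ⁻¹' {y}).encard ≤ K) (hh : Integrable h μ) :
    Integrable (fun y => ((s ∩ f ⁻¹' {y}).ncard : ℝ) • h y) μ := by
  simpa only [toReal_toENNReal_encard] using (integrable_withDensity_iff_integrable_smul'
    (measurable_encard_inter_preimage_singleton hs hf' hdet) (ae_toENNReal_encard_lt_top hK)).1
    (integrable_withDensity_encard hK hh)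

variable (μ : Measure E) [μ.IsAddHaarMeasure]

theorem lintegral_abs_det_mul_comp (hs : MeasurableSet s)
    (hf' : ∀ x ∈ s, HasFDerivWithinAt f (f' x) s x) (hdet : ∀ x ∈ s, (f' x).det ≠ 0)
    {g : E → ℝ≥0∞} (hg : Measurable g) :
    ∫⁻ x in s, ENNReal.ofReal |(f' x).det| * g (f x) ∂μ =
      ∫⁻ y, ((s ∩ f ⁻¹' {y}).encard : ℝ≥0∞) * g y ∂μ := by
  obtain ⟨t, hdisj, ht, hinj, rfl⟩ := exists_measurable_partition_injOn hs hf' hdet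
  have hft : ∀ n, ∀ x ∈ t n, HasFDerivWithinAt f (f' x) (t n) x := fun n x hx =>
    (hf' x (mem_iUnion_of_mem n hx)).mono (subset_iUnion t n)
  have himage : ∀ n, MeasurableSet (f '' t n) := fun n =>
    measurable_image_of_fderivWithin (ht n) (hft n) (hinj n)
  simp_rw [toENNReal_encard_iUnion_inter_preimage_singleton hdisj hinj, ← ENNReal.tsum_mul_right]
  have hmeas : ∀ n, AEMeasurable
      (fun y => (f '' t n).indicator (fun _ => (1 : ℝ≥0∞)) y * g y) μ := fun n =>
    ((measurable_const.indicator (himage n)).mul hg).aemeasurable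
  rw [lintegral_tsum hmeas, lintegral_iUnion ht hdisj]
  refine tsum_congr fun n => ?_
  rw [← lintegral_image_eq_lintegral_abs_det_fderiv_mul μ (ht n) (hft n) (hinj n),
    ← lintegral_indicator (himage n)]
  refine lintegral_congr fun y => ?_
  by_cases hy : y ∈ f '' t n <;> simp [hy]

theorem map_withDensity_abs_det (hs : MeasurableSet s) (hf : Measurable f)
    (hf' : ∀ x ∈ s, HasFDerivWithinAt f (f' x) s x) (hdet : ∀ x ∈ s, (f' x).det ≠ 0) :
    ((μ.restrict s).withDensity fun x => ENNReal.ofReal |(f' x).det|).map f =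
      μ.withDensity fun y => ((s ∩ f ⁻¹' {y}).encard : ℝ≥0∞) := by
  ext B hB
  rw [Measure.map_apply hf hB, withDensity_apply _ (hf hB), withDensity_apply _ hB,
    ← lintegral_indicator (hf hB), ← lintegral_indicator hB]
  convert lintegral_abs_det_mul_comp μ hs hf' hdet (measurable_one.indicator hB)
  · simp only [indicator, mem_preimage, Pi.one_apply, mul_ite, mul_one, mul_zero]
    rfl
  · simp [indicator]

variable {F : Type*} [NormedAddCommGroup F] [NormedSpace ℝ F] {h : E → F}

theorem integrableOn_abs_det_smul_comp (hs : MeasurableSet s) (hf : Measurable f)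
    (hf' : ∀ x ∈ s, HasFDerivWithinAt f (f' x) s x) (hdet : ∀ x ∈ s, (f' x).det ≠ 0) {K : ℕ}
    (hK : ∀ᵐ y ∂μ, (s ∩ f ⁻¹' {y}).encard ≤ K) (hh : Integrable h μ) :
    IntegrableOn (fun x => |(f' x).det| • h (f x)) s μ := by
  have hcount := integrable_withDensity_encard hK hh
  rw [← map_withDensity_abs_det μ hs hf hf' hdet] at hcount
  simpa [IntegrableOn] using (integrable_withDensity_iff_integrable_smul₀'
    (aemeasurable_ofReal_abs_det_fderivWithin μ hs hf')
    (.of_forall fun _ => ENNReal.ofReal_lt_top)).1 (hcount.comp_measurable hf)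

theorem setIntegral_abs_det_smul_comp (hs : MeasurableSet s) (hf : Measurable f)
    (hf' : ∀ x ∈ s, HasFDerivWithinAt f (f' x) s x) (hdet : ∀ x ∈ s, (f' x).det ≠ 0) {K : ℕ}
    (hK : ∀ᵐ y ∂μ, (s ∩ f ⁻¹' {y}).encard ≤ K) (hh : Integrable h μ) :
    ∫ x in s, |(f' x).det| • h (f x) ∂μ = ∫ y, ((s ∩ f ⁻¹' {y}).ncard : ℝ) • h y ∂μ := by
  have hcount := integrable_withDensity_encard hK hh
  rw [← map_withDensity_abs_det μ hs hf hf' hdet] at hcount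
  have hmap := integral_map hf.aemeasurable hcount.aestronglyMeasurable
  rw [map_withDensity_abs_det μ hs hf hf' hdet,
    integral_withDensity_eq_integral_toReal_smul₀
      (aemeasurable_ofReal_abs_det_fderivWithin μ hs hf')
      (.of_forall fun _ => ENNReal.ofReal_lt_top),
    integral_withDensity_eq_integral_toReal_smul
      (measurable_encard_inter_preimage_singleton hs hf' hdet)
      (ae_toENNReal_encard_lt_top hK)] at hmap
  simpa [toReal_toENNReal_encard] using hmap.symm

end AreaFormula

section SignedAreaFormula

open Set

/-- The number of points of the fibre of `f` over `y`, each counted with the sign of `J` there. It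
is `0` by convention if infinitely many points of the fibre have a nonzero sign. -/
def signedFiberCount {α β : Type*} (f : α → β) (J : α → ℝ) (y : β) : ℤ :=
  ∑ᶠ x ∈ f ⁻¹' {y}, (SignType.sign (J x) : ℤ)

theorem signedFiberCount_eq_ncard_sub_ncard {α β : Type*} {f : α → β} (J : α → ℝ) {y : β}
    (hfin : (f ⁻¹' {y}).Finite) :
    signedFiberCount f J y =
      ((({x | 0 < J x} ∩ f ⁻¹' {y}).ncard : ℤ) - ({x | J x < 0} ∩ f ⁻¹' {y}).ncard) := by
  classical
  have hsign : ∀ x, (SignType.sign (J x) : ℤ) =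
      (if 0 < J x then 1 else 0) - (if J x < 0 then 1 else 0) := fun x => by
    rcases lt_trichotomy (J x) 0 with h | h | h
    · simp [h, h.not_gt]
    · simp [h]
    · simp [h, h.not_gt]
  have hncard : ∀ p : α → Prop, (({x | p x} ∩ f ⁻¹' {y}).ncard : ℤ) =
      ∑ x ∈ hfin.toFinset, if p x then 1 else 0 := fun p => by
    rw [Finset.sum_boole, ← ncard_coe_finset]
    congr 3
    ext x
    simp [and_comm]
  rw [signedFiberCount, finsum_mem_eq_finite_toFinset_sum _ hfin, hncard, hncard,
    ← Finset.sum_sub_distrib]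
  exact Finset.sum_congr rfl fun x _ => hsign x

theorem smul_eq_indicator_sub_indicator {α F : Type*} [AddCommGroup F] [Module ℝ F] (J : α → ℝ)
    (v : α → F) (x : α) :
    J x • v x = {x | 0 < J x}.indicator (fun x => |J x| • v x) x -
      {x | J x < 0}.indicator (fun x => |J x| • v x) x := by
  rcases lt_trichotomy (J x) 0 with h | h | h
  · simp [h, h.not_gt, abs_of_neg h]
  · simp [h]
  · simp [h, h.not_gt, abs_of_pos h]

theorem measurable_of_hasFDerivAt {E F : Type*} [NormedAddCommGroup E] [NormedSpace ℝ E]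
    [MeasurableSpace E] [BorelSpace E] [NormedAddCommGroup F] [NormedSpace ℝ F]
    [MeasurableSpace F] [BorelSpace F] {f : E → F} {f' : E → E →L[ℝ] F}
    (hf' : ∀ x, HasFDerivAt f (f' x) x) : Measurable f :=
  (continuous_iff_continuousAt.2 fun x => (hf' x).continuousAt).measurable

theorem signedFiberCount_smul_ae_eq {α β F : Type*} [MeasurableSpace β] {μ : Measure β}
    [AddCommGroup F] [Module ℝ F] {f : α → β} {J : α → ℝ} {h : β → F} {K : ℕ}
    (hK : ∀ᵐ y ∂μ, (f ⁻¹' {y}).encard ≤ K) :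
    (fun y => (signedFiberCount f J y : ℝ) • h y) =ᵐ[μ] fun y =>
      (({x | 0 < J x} ∩ f ⁻¹' {y}).ncard : ℝ) • h y -
        (({x | J x < 0} ∩ f ⁻¹' {y}).ncard : ℝ) • h y := by
  refine hK.mono fun y hy => ?_
  simp only [← sub_smul]
  rw [signedFiberCount_eq_ncard_sub_ncard J (finite_of_encard_le_coe hy)]
  push_cast
  rfl

variable {E F : Type*} [NormedAddCommGroup E] [NormedSpace ℝ E] [FiniteDimensional ℝ E]
  [MeasurableSpace E] [BorelSpace E] (μ : Measure E) [NormedAddCommGroup F] [NormedSpace ℝ F]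
  {f : E → E} {f' : E → E →L[ℝ] E} {J : E → ℝ} {K : ℕ} {h : E → F}

theorem integrable_ncard_smul_of_ne_zero {s : Set E} (hs : MeasurableSet s)
    (hs_ne : ∀ x ∈ s, J x ≠ 0) (hf' : ∀ x, HasFDerivAt f (f' x) x)
    (hJ : ∀ x, |(f' x).det| = |J x|) (hK : ∀ᵐ y ∂μ, (f ⁻¹' {y}).encard ≤ K)
    (hh : Integrable h μ) : Integrable (fun y => ((s ∩ f ⁻¹' {y}).ncard : ℝ) • h y) μ :=
  integrable_ncard_smul hs (fun x _ => (hf' x).hasFDerivWithinAt)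
    (fun x hx => abs_ne_zero.1 (hJ x ▸ abs_ne_zero.2 (hs_ne x hx)))
    (hK.mono fun _ hy => (encard_le_encard inter_subset_right).trans hy) hh

theorem integrable_signedFiberCount_smul (hf' : ∀ x, HasFDerivAt f (f' x) x) (hJm : Measurable J)
    (hJ : ∀ x, |(f' x).det| = |J x|) (hK : ∀ᵐ y ∂μ, (f ⁻¹' {y}).encard ≤ K)
    (hh : Integrable h μ) : Integrable (fun y => (signedFiberCount f J y : ℝ) • h y) μ :=
  ((integrable_ncard_smul_of_ne_zero μ (measurableSet_lt measurable_const hJm)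
    (fun _ hx => ne_of_gt hx) hf' hJ hK hh).sub (integrable_ncard_smul_of_ne_zero μ
    (measurableSet_lt hJm measurable_const) (fun _ hx => ne_of_lt hx) hf' hJ hK hh)).congr
    (signedFiberCount_smul_ae_eq hK).symm

variable [μ.IsAddHaarMeasure]

theorem integrable_indicator_abs_smul_comp {s : Set E} (hs : MeasurableSet s)
    (hs_ne : ∀ x ∈ s, J x ≠ 0) (hf' : ∀ x, HasFDerivAt f (f' x) x)
    (hJ : ∀ x, |(f' x).det| = |J x|) (hK : ∀ᵐ y ∂μ, (f ⁻¹' {y}).encard ≤ K)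
    (hh : Integrable h μ) : Integrable (s.indicator fun x => |J x| • h (f x)) μ := by
  simp_rw [← hJ]
  exact (integrable_indicator_iff hs).2 <| integrableOn_abs_det_smul_comp μ hs
    (measurable_of_hasFDerivAt hf') (fun x _ => (hf' x).hasFDerivWithinAt)
    (fun x hx => abs_ne_zero.1 (hJ x ▸ abs_ne_zero.2 (hs_ne x hx)))
    (hK.mono fun y hy => (encard_le_encard inter_subset_right).trans hy) hh

theorem integral_indicator_abs_smul_comp {s : Set E} (hs : MeasurableSet s)
    (hs_ne : ∀ x ∈ s, J x ≠ 0) (hf' : ∀ x, HasFDerivAt f (f' x) x)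
    (hJ : ∀ x, |(f' x).det| = |J x|) (hK : ∀ᵐ y ∂μ, (f ⁻¹' {y}).encard ≤ K)
    (hh : Integrable h μ) :
    ∫ x, s.indicator (fun x => |J x| • h (f x)) x ∂μ =
      ∫ y, ((s ∩ f ⁻¹' {y}).ncard : ℝ) • h y ∂μ := by
  simp_rw [← hJ]
  rw [integral_indicator hs]
  exact setIntegral_abs_det_smul_comp μ hs (measurable_of_hasFDerivAt hf')
    (fun x _ => (hf' x).hasFDerivWithinAt)
    (fun x hx => abs_ne_zero.1 (hJ x ▸ abs_ne_zero.2 (hs_ne x hx)))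
    (hK.mono fun y hy => (encard_le_encard inter_subset_right).trans hy) hh

theorem integrable_smul_comp (hf' : ∀ x, HasFDerivAt f (f' x) x) (hJm : Measurable J)
    (hJ : ∀ x, |(f' x).det| = |J x|) (hK : ∀ᵐ y ∂μ, (f ⁻¹' {y}).encard ≤ K)
    (hh : Integrable h μ) : Integrable (fun x => J x • h (f x)) μ := by
  simp_rw [smul_eq_indicator_sub_indicator J (fun x => h (f x))]
  exact (integrable_indicator_abs_smul_comp μ (measurableSet_lt measurable_const hJm)
    (fun x hx => ne_of_gt hx) hf' hJ hK hh).sub (integrable_indicator_abs_smul_comp μ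
    (measurableSet_lt hJm measurable_const) (fun x hx => ne_of_lt hx) hf' hJ hK hh)

theorem integral_smul_comp (hf' : ∀ x, HasFDerivAt f (f' x) x) (hJm : Measurable J)
    (hJ : ∀ x, |(f' x).det| = |J x|) (hK : ∀ᵐ y ∂μ, (f ⁻¹' {y}).encard ≤ K)
    (hh : Integrable h μ) :
    ∫ x, J x • h (f x) ∂μ = ∫ y, (signedFiberCount f J y : ℝ) • h y ∂μ := by
  have hpos : MeasurableSet {x | 0 < J x} := measurableSet_lt measurable_const hJm
  have hneg : MeasurableSet {x | J x < 0} := measurableSet_lt hJm measurable_const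
  have hpos_ne : ∀ x ∈ {x | 0 < J x}, J x ≠ 0 := fun x hx => ne_of_gt hx
  have hneg_ne : ∀ x ∈ {x | J x < 0}, J x ≠ 0 := fun x hx => ne_of_lt hx
  simp_rw [smul_eq_indicator_sub_indicator J (fun x => h (f x))]
  rw [integral_sub (integrable_indicator_abs_smul_comp μ hpos hpos_ne hf' hJ hK hh)
      (integrable_indicator_abs_smul_comp μ hneg hneg_ne hf' hJ hK hh),
    integral_indicator_abs_smul_comp μ hpos hpos_ne hf' hJ hK hh,
    integral_indicator_abs_smul_comp μ hneg hneg_ne hf' hJ hK hh,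
    integral_congr_ae (signedFiberCount_smul_ae_eq hK),
    integral_sub (integrable_ncard_smul_of_ne_zero μ hpos hpos_ne hf' hJ hK hh)
      (integrable_ncard_smul_of_ne_zero μ hneg hneg_ne hf' hJ hK hh)]

end SignedAreaFormula

section MonicPoly

variable {R S : Type*} [CommRing R] [CommRing S] {n : ℕ}

/-- The polynomial `∑ bᵢ Xⁱ` of degree less than `n`, as a linear function of its coefficients. -/
def lowPoly (n : ℕ) : (Fin n → R) →ₗ[R] R[X] :=
  Fintype.linearCombination R fun i : Fin n => X ^ (i : ℕ)

/-- The monic polynomial `Xⁿ + ∑ bᵢ Xⁱ`. -/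
def monicPoly (b : Fin n → R) : R[X] := X ^ n + lowPoly n b

theorem lowPoly_apply (b : Fin n → R) : lowPoly n b = ∑ i, C (b i) * X ^ (i : ℕ) := by
  simp only [lowPoly, Fintype.linearCombination_apply, smul_eq_C_mul]

theorem lowPoly_coeff (b : Fin n → R) (k : ℕ) :
    (lowPoly n b).coeff k = if h : k < n then b ⟨k, h⟩ else 0 := by
  simp only [lowPoly_apply, finsetSum_coeff, coeff_C_mul, coeff_X_pow, mul_ite, mul_one, mul_zero]
  split_ifs with h
  · rw [Finset.sum_eq_single_of_mem ⟨k, h⟩ (Finset.mem_univ _) fun i _ hi =>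
      if_neg fun hk => hi (Fin.ext hk.symm)]
    simp
  · exact Finset.sum_eq_zero fun i _ => if_neg fun (hk : k = i) => h (hk ▸ i.2)

theorem degree_lowPoly_lt (b : Fin n → R) : (lowPoly n b).degree < n := by
  rw [degree_lt_iff_coeff_zero]
  intro k hk
  rw [lowPoly_coeff, dif_neg hk.not_gt]

theorem lowPoly_single (i : Fin n) : lowPoly n (Pi.single i (1 : R)) = X ^ (i : ℕ) := by
  rw [lowPoly, Fintype.linearCombination_apply_single, one_smul]

theorem monic_monicPoly (b : Fin n → R) : (monicPoly b).Monic :=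
  monic_X_pow_add (degree_lowPoly_lt b)

theorem natDegree_monicPoly [Nontrivial R] (b : Fin n → R) : (monicPoly b).natDegree = n :=
  natDegree_eq_of_degree_eq_some <| by
    rw [monicPoly, degree_add_eq_left_of_degree_lt] <;> simp [degree_lowPoly_lt]

theorem monicPoly_coeff (b : Fin n → R) (i : Fin n) : (monicPoly b).coeff i = b i := by
  rw [monicPoly, coeff_add, coeff_X_pow, lowPoly_coeff, if_neg i.2.ne, dif_pos i.2, zero_add]

theorem monicPoly_injective : Function.Injective (monicPoly : (Fin n → R) → R[X]) := by
  intro b c h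
  ext i
  rw [← monicPoly_coeff b, h, monicPoly_coeff]

theorem monicPoly_coeff_eq_self {p : R[X]} (hp : p.Monic) (hn : p.natDegree = n) :
    monicPoly (fun i : Fin n => p.coeff i) = p := by
  ext k
  rw [monicPoly, coeff_add, coeff_X_pow, lowPoly_coeff]
  rcases lt_trichotomy k n with h | rfl | h
  · simp [h, h.ne]
  · simpa [← hn] using hp.symm
  · simp [h.ne', h.not_gt, coeff_eq_zero_of_natDegree_lt (hn ▸ h)]

theorem map_monicPoly (φ : R →+* S) (b : Fin n → R) :
    (monicPoly b).map φ = monicPoly (φ ∘ b) := by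
  simp [monicPoly, lowPoly_apply, Polynomial.map_sum]

theorem algebraMap_resultant_two [Algebra R S] {q g : R[X]} {α β : S} (hg : g.natDegree ≤ n)
    (hq : q.map (algebraMap R S) = (X - C α) * (X - C β)) :
    algebraMap R S (resultant q g 2 n) = aeval α g * aeval β g := by
  nontriviality S
  have hg' : (g.map (algebraMap R S)).natDegree ≤ n := natDegree_map_le.trans hg
  have hmul := resultant_mul_left (X - C α) (X - C β) (g.map (algebraMap R S)) n hg'
  simp only [natDegree_X_sub_C] at hmul
  rw [← resultant_map_map, hq, hmul, resultant_X_sub_C_left _ _ _ hg',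
    resultant_X_sub_C_left _ _ _ hg', eval_map_algebraMap, eval_map_algebraMap]

end MonicPoly

section ParamMulMap

variable {𝕜 : Type*} {m n : ℕ}

/-- The first `m` coordinates of a vector of `m + n` coordinates. -/
def leftPart (z : Fin (m + n) → 𝕜) : Fin m → 𝕜 := fun i => z (Fin.castAdd n i)

/-- The last `n` coordinates of a vector of `m + n` coordinates. -/
def rightPart (z : Fin (m + n) → 𝕜) : Fin n → 𝕜 := fun i => z (Fin.natAdd m i)

theorem leftPart_append (a : Fin m → 𝕜) (b : Fin n → 𝕜) : leftPart (Fin.append a b) = a := by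
  ext i; simp [leftPart]

theorem rightPart_append (a : Fin m → 𝕜) (b : Fin n → 𝕜) : rightPart (Fin.append a b) = b := by
  ext i; simp [rightPart]

theorem append_leftPart_rightPart (z : Fin (m + n) → 𝕜) :
    Fin.append (leftPart z) (rightPart z) = z := by
  ext i
  induction i using Fin.addCases <;> simp [leftPart, rightPart]

/-- Multiplication of a monic polynomial of degree `m`, whose coefficients are given in the
parametrization `ρ`, with a monic polynomial of degree `n`, in terms of coefficients. -/
def paramMulMap [CommRing 𝕜] (ρ : (Fin m → 𝕜) → Fin m → 𝕜) (z : Fin (m + n) → 𝕜) :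
    Fin (m + n) → 𝕜 :=
  fun k => (monicPoly (ρ (leftPart z)) * monicPoly (rightPart z)).coeff k

theorem monicPoly_paramMulMap [CommRing 𝕜] (ρ : (Fin m → 𝕜) → Fin m → 𝕜) (z : Fin (m + n) → 𝕜) :
    monicPoly (paramMulMap ρ z) = monicPoly (ρ (leftPart z)) * monicPoly (rightPart z) := by
  nontriviality 𝕜
  refine monicPoly_coeff_eq_self ((monic_monicPoly _).mul (monic_monicPoly _)) ?_
  rw [(monic_monicPoly _).natDegree_mul (monic_monicPoly _), natDegree_monicPoly,
    natDegree_monicPoly]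

/-- The linear map `(u, v) ↦ u g + q v`, in terms of coefficients; it is the derivative of
multiplication at `(q, g)`. -/
def mulDeriv [CommRing 𝕜] (q : Fin m → 𝕜) (g : Fin n → 𝕜) :
    (Fin (m + n) → 𝕜) →ₗ[𝕜] (Fin (m + n) → 𝕜) :=
  LinearMap.pi fun k => lcoeff 𝕜 (k : ℕ) ∘ₗ
    (LinearMap.mulRight 𝕜 (monicPoly g) ∘ₗ lowPoly m ∘ₗ LinearMap.funLeft 𝕜 𝕜 (Fin.castAdd n) +
      LinearMap.mulLeft 𝕜 (monicPoly q) ∘ₗ lowPoly n ∘ₗ LinearMap.funLeft 𝕜 𝕜 (Fin.natAdd m))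

theorem mulDeriv_apply [CommRing 𝕜] (q : Fin m → 𝕜) (g : Fin n → 𝕜) (h : Fin (m + n) → 𝕜)
    (k : Fin (m + n)) : mulDeriv q g h k = (lowPoly m (leftPart h) * monicPoly g +
      monicPoly q * lowPoly n (rightPart h)).coeff k :=
  rfl

theorem leftPart_single_castAdd [Zero 𝕜] (j : Fin m) (a : 𝕜) :
    leftPart (Pi.single (Fin.castAdd n j) a) = Pi.single j a := by
  ext k; simp [leftPart, Pi.single_apply]

theorem rightPart_single_castAdd [Zero 𝕜] (j : Fin m) (a : 𝕜) :
    rightPart (Pi.single (Fin.castAdd n j) a) = 0 := by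
  ext k; simp [rightPart, Fin.ext_iff, (j.2.trans_le (Nat.le_add_right m k)).ne']

theorem leftPart_single_natAdd [Zero 𝕜] (j : Fin n) (a : 𝕜) :
    leftPart (Pi.single (Fin.natAdd m j) a) = 0 := by
  ext k; simp [leftPart, Fin.ext_iff, (k.2.trans_le (Nat.le_add_right m j)).ne]

theorem rightPart_single_natAdd [Zero 𝕜] (j : Fin n) (a : 𝕜) :
    rightPart (Pi.single (Fin.natAdd m j) a) = Pi.single j a := by
  ext k; simp [rightPart, Pi.single_apply]

theorem toMatrix'_mulDeriv [CommRing 𝕜] (q : Fin m → 𝕜) (g : Fin n → 𝕜) :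
    LinearMap.toMatrix' (mulDeriv q g) = sylvester (monicPoly q) (monicPoly g) m n := by
  nontriviality 𝕜
  have hq : (monicPoly q).natDegree = m := natDegree_monicPoly q
  have hg : (monicPoly g).natDegree = n := natDegree_monicPoly g
  ext i j
  rw [LinearMap.toMatrix'_apply, mulDeriv_apply]
  induction j using Fin.addCases with
  | left j =>
    simp only [leftPart_single_castAdd, rightPart_single_castAdd, lowPoly_single, map_zero,
      mul_zero, add_zero, coeff_X_pow_mul', sylvester, Matrix.of_apply, Fin.addCases_left,
      Set.mem_Icc, ite_and]
    split_ifs with h₁ h₂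
    · rfl
    · exact coeff_eq_zero_of_natDegree_lt (by omega)
    · rfl
  | right j =>
    simp only [leftPart_single_natAdd, rightPart_single_natAdd, lowPoly_single, map_zero,
      zero_mul, zero_add, coeff_mul_X_pow', sylvester, Matrix.of_apply, Fin.addCases_right,
      Set.mem_Icc, ite_and]
    split_ifs with h₁ h₂
    · rfl
    · exact coeff_eq_zero_of_natDegree_lt (by omega)
    · rfl

theorem det_mulDeriv [CommRing 𝕜] (q : Fin m → 𝕜) (g : Fin n → 𝕜) :
    LinearMap.det (mulDeriv q g) = resultant (monicPoly q) (monicPoly g) m n := by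
  rw [← LinearMap.det_toMatrix', toMatrix'_mulDeriv, resultant]

/-- The endomorphism of `𝕜^(m+n)` which is `A` on the first `m` coordinates and the identity on the
others. -/
def blockMap [CommRing 𝕜] (n : ℕ) (A : Matrix (Fin m) (Fin m) 𝕜) :
    (Fin (m + n) → 𝕜) →ₗ[𝕜] (Fin (m + n) → 𝕜) :=
  Matrix.toLin' ((Matrix.fromBlocks A 0 0 1).reindex finSumFinEquiv finSumFinEquiv)

theorem det_blockMap [CommRing 𝕜] (A : Matrix (Fin m) (Fin m) 𝕜) :
    LinearMap.det (blockMap n A) = A.det := by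
  rw [blockMap, LinearMap.det_toLin', Matrix.det_reindex_self, Matrix.det_fromBlocks_zero₂₁,
    Matrix.det_one, mul_one]

theorem blockMap_apply [CommRing 𝕜] (A : Matrix (Fin m) (Fin m) 𝕜) (z : Fin (m + n) → 𝕜) :
    blockMap n A z = Fin.append (A.mulVec (leftPart z)) (rightPart z) := by
  ext i
  rw [blockMap, Matrix.toLin'_apply, Matrix.mulVec, dotProduct, ← finSumFinEquiv.sum_comp,
    Fintype.sum_sum_type]
  induction i using Fin.addCases with
  | left i => simp [leftPart, Matrix.mulVec, dotProduct]
  | right i => simp [rightPart, Matrix.one_apply]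

variable [NontriviallyNormedField 𝕜] [CompleteSpace 𝕜] {ρ : (Fin m → 𝕜) → Fin m → 𝕜}
  {A : Matrix (Fin m) (Fin m) 𝕜} {z : Fin (m + n) → 𝕜}

/-- The derivative of `paramMulMap ρ` at `z` if `A` is that of `ρ` at `leftPart z`. -/
def paramMulDeriv (ρ : (Fin m → 𝕜) → Fin m → 𝕜) (A : Matrix (Fin m) (Fin m) 𝕜)
    (z : Fin (m + n) → 𝕜) : (Fin (m + n) → 𝕜) →L[𝕜] (Fin (m + n) → 𝕜) :=
  LinearMap.toContinuousLinearMap (mulDeriv (ρ (leftPart z)) (rightPart z) ∘ₗ blockMap n A)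

theorem paramMulDeriv_apply (h : Fin (m + n) → 𝕜) (k : Fin (m + n)) :
    paramMulDeriv ρ A z h k =
      (lowPoly m (A.mulVec (leftPart h)) * monicPoly (rightPart z) +
        monicPoly (ρ (leftPart z)) * lowPoly n (rightPart h)).coeff k := by
  rw [paramMulDeriv, LinearMap.coe_toContinuousLinearMap', LinearMap.comp_apply, mulDeriv_apply,
    blockMap_apply, leftPart_append, rightPart_append]

theorem hasFDerivAt_monicPoly_coeff {E : Type*} [NormedAddCommGroup E] [NormedSpace 𝕜 E]
    {b : E → Fin n → 𝕜} {b' : E →L[𝕜] Fin n → 𝕜} {x : E} (hb : HasFDerivAt b b' x) (j : ℕ) :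
    HasFDerivAt (fun x => (monicPoly (b x)).coeff j)
      (LinearMap.toContinuousLinearMap (lcoeff 𝕜 j ∘ₗ lowPoly n) ∘L b') x := by
  simp only [monicPoly, coeff_add]
  exact ((LinearMap.toContinuousLinearMap (lcoeff 𝕜 j ∘ₗ lowPoly n)).hasFDerivAt.comp x
    hb).const_add _

theorem hasFDerivAt_paramMulMap
    (hρ : HasFDerivAt ρ (LinearMap.toContinuousLinearMap (Matrix.toLin' A)) (leftPart z)) :
    HasFDerivAt (paramMulMap ρ) (paramMulDeriv ρ A z) z := by
  have hleft : HasFDerivAt (leftPart : (Fin (m + n) → 𝕜) → _)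
      (LinearMap.toContinuousLinearMap (LinearMap.funLeft 𝕜 𝕜 (Fin.castAdd n))) z :=
    ContinuousLinearMap.hasFDerivAt
      (LinearMap.toContinuousLinearMap (LinearMap.funLeft 𝕜 𝕜 (Fin.castAdd n)))
  have hright : HasFDerivAt (rightPart : (Fin (m + n) → 𝕜) → _)
      (LinearMap.toContinuousLinearMap (LinearMap.funLeft 𝕜 𝕜 (Fin.natAdd m))) z :=
    ContinuousLinearMap.hasFDerivAt
      (LinearMap.toContinuousLinearMap (LinearMap.funLeft 𝕜 𝕜 (Fin.natAdd m)))
  rw [hasFDerivAt_pi']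
  intro k
  simp only [paramMulMap, coeff_mul]
  refine (HasFDerivAt.fun_sum fun x _ =>
    (hasFDerivAt_monicPoly_coeff (hρ.comp z hleft) x.1).mul
      (hasFDerivAt_monicPoly_coeff hright x.2)).congr_fderiv ?_
  ext h
  simp only [sum_apply, add_apply, smul_apply, ContinuousLinearMap.comp_apply,
    ContinuousLinearMap.proj_apply, paramMulDeriv_apply, coeff_add, coeff_mul, smul_eq_mul,
    ← Finset.sum_add_distrib]
  refine Finset.sum_congr rfl fun x _ => ?_
  rw [mul_comm (Polynomial.coeff (lowPoly m _) _), add_comm]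
  rfl

theorem det_paramMulDeriv : (paramMulDeriv ρ A z).det =
    resultant (monicPoly (ρ (leftPart z))) (monicPoly (rightPart z)) m n * A.det := by
  rw [paramMulDeriv, LinearMap.det_toContinuousLinearMap, LinearMap.det_comp, det_mulDeriv,
    det_blockMap]

end ParamMulMap

section Parametrizations

variable {n : ℕ}

/-- The coefficients of the quadratic polynomial with the two real roots `v 0`, `v 1`. -/
def realPair (v : Fin 2 → ℝ) : Fin 2 → ℝ := ![v 0 * v 1, -(v 0 + v 1)]

/-- The coefficients of the real quadratic polynomial with the root `v 0 + i v 1`. -/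
def conjPair (v : Fin 2 → ℝ) : Fin 2 → ℝ := ![v 0 ^ 2 + v 1 ^ 2, -(2 * v 0)]

theorem monicPoly_realPair (v : Fin 2 → ℝ) :
    monicPoly (realPair v) = (X - C (v 0)) * (X - C (v 1)) := by
  simp only [monicPoly, lowPoly_apply, Fin.sum_univ_two, realPair, Matrix.cons_val_zero,
    Matrix.cons_val_one, Fin.val_zero, Fin.val_one, map_mul, map_neg, map_add]
  ring

theorem monicPoly_conjPair (v : Fin 2 → ℝ) :
    monicPoly (conjPair v) = X ^ 2 - C (2 * v 0) * X + C (v 0 ^ 2 + v 1 ^ 2) := by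
  simp only [monicPoly, lowPoly_apply, Fin.sum_univ_two, conjPair, Matrix.cons_val_zero,
    Matrix.cons_val_one, Fin.val_zero, Fin.val_one, map_neg]
  ring

theorem map_monicPoly_conjPair (v : Fin 2 → ℝ) :
    (monicPoly (conjPair v)).map (algebraMap ℝ ℂ) =
      (X - C (starRingEnd ℂ ⟨v 0, v 1⟩)) * (X - C (⟨v 0, v 1⟩ : ℂ)) := by
  have h : (C Complex.I : ℂ[X]) ^ 2 = -1 := by simp [← C_pow, Complex.I_sq]
  rw [monicPoly_conjPair, Complex.mk_eq_add_mul_I]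
  simp only [Polynomial.map_add, Polynomial.map_sub, Polynomial.map_mul, Polynomial.map_pow, map_X,
    map_C, Polynomial.map_ofNat, Complex.coe_algebraMap, map_add, map_mul, map_pow,
    Complex.conj_ofReal, Complex.conj_I, map_neg, map_ofNat]
  linear_combination C (v 1 : ℂ) ^ 2 * h

/-- The derivative of `realPair`. -/
def realPairDeriv (v : Fin 2 → ℝ) : Matrix (Fin 2) (Fin 2) ℝ := !![v 1, v 0; -1, -1]

/-- The derivative of `conjPair`. -/
def conjPairDeriv (v : Fin 2 → ℝ) : Matrix (Fin 2) (Fin 2) ℝ := !![2 * v 0, 2 * v 1; -2, 0]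

theorem hasFDerivAt_realPair (v : Fin 2 → ℝ) : HasFDerivAt realPair
    (LinearMap.toContinuousLinearMap (Matrix.toLin' (realPairDeriv v))) v := by
  have h₀ := hasFDerivAt_apply (𝕜 := ℝ) (0 : Fin 2) v
  have h₁ := hasFDerivAt_apply (𝕜 := ℝ) (1 : Fin 2) v
  rw [hasFDerivAt_pi']
  intro k
  fin_cases k
  · refine (h₀.mul h₁).congr_fderiv ?_
    ext h
    simp [realPairDeriv, dotProduct]
    ring
  · refine (h₀.add h₁).neg.congr_fderiv ?_
    ext h
    simp [realPairDeriv, dotProduct]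
    ring

theorem hasFDerivAt_conjPair (v : Fin 2 → ℝ) : HasFDerivAt conjPair
    (LinearMap.toContinuousLinearMap (Matrix.toLin' (conjPairDeriv v))) v := by
  have h₀ := hasFDerivAt_apply (𝕜 := ℝ) (0 : Fin 2) v
  have h₁ := hasFDerivAt_apply (𝕜 := ℝ) (1 : Fin 2) v
  rw [hasFDerivAt_pi']
  intro k
  fin_cases k
  · refine ((h₀.pow 2).add (h₁.pow 2)).congr_fderiv ?_
    ext h
    simp [conjPairDeriv, dotProduct]
  · refine (h₀.const_mul 2).neg.congr_fderiv ?_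
    ext h
    simp [conjPairDeriv, dotProduct]

/-- The signed Jacobian of `paramMulMap realPair`: the factor `|x - y|` is taken in absolute value,
the resultant `g(x) g(y)` with its sign. -/
def realJac (z : Fin (2 + n) → ℝ) : ℝ :=
  |leftPart z 1 - leftPart z 0| *
    ((monicPoly (rightPart z)).eval (leftPart z 0) * (monicPoly (rightPart z)).eval (leftPart z 1))

/-- The Jacobian of `paramMulMap conjPair`, in absolute value. -/
def conjJac (z : Fin (2 + n) → ℝ) : ℝ :=
  4 * |leftPart z 1| * ‖aeval (⟨leftPart z 0, leftPart z 1⟩ : ℂ) (monicPoly (rightPart z))‖ ^ 2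

theorem resultant_realPair (v : Fin 2 → ℝ) (b : Fin n → ℝ) :
    resultant (monicPoly (realPair v)) (monicPoly b) 2 n =
      (monicPoly b).eval (v 0) * (monicPoly b).eval (v 1) := by
  have h := algebraMap_resultant_two (S := ℝ) (natDegree_monicPoly b).le
    ((map_id (p := monicPoly (realPair v))).trans (monicPoly_realPair v))
  simpa only [coe_aeval_eq_eval, Algebra.algebraMap_self_apply] using h

theorem resultant_conjPair (v : Fin 2 → ℝ) (b : Fin n → ℝ) :
    resultant (monicPoly (conjPair v)) (monicPoly b) 2 n =
      ‖aeval (⟨v 0, v 1⟩ : ℂ) (monicPoly b)‖ ^ 2 := by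
  have h := algebraMap_resultant_two (natDegree_monicPoly b).le (map_monicPoly_conjPair v)
  rw [aeval_conj, Complex.conj_mul'] at h
  exact Complex.ofReal_injective (by simpa using h)

theorem abs_det_realPair (z : Fin (2 + n) → ℝ) :
    |(paramMulDeriv realPair (realPairDeriv (leftPart z)) z).det| = |realJac z| := by
  have hdet : (realPairDeriv (leftPart z)).det = leftPart z 0 - leftPart z 1 := by
    rw [realPairDeriv, Matrix.det_fin_two_of]
    ring
  rw [det_paramMulDeriv, resultant_realPair, hdet, realJac, abs_mul _ (_ - _), abs_mul |_|, abs_abs,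
    mul_comm, abs_sub_comm]

theorem abs_det_conjPair (z : Fin (2 + n) → ℝ) :
    |(paramMulDeriv conjPair (conjPairDeriv (leftPart z)) z).det| = |conjJac z| := by
  have hdet : (conjPairDeriv (leftPart z)).det = 4 * leftPart z 1 := by
    rw [conjPairDeriv, Matrix.det_fin_two_of]
    ring
  rw [det_paramMulDeriv, resultant_conjPair, hdet, conjJac, abs_mul, abs_mul, abs_mul, abs_mul,
    abs_abs, mul_comm]

theorem conjJac_nonneg (z : Fin (2 + n) → ℝ) : 0 ≤ conjJac z := by
  unfold conjJac
  positivity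

end Parametrizations

section SignCount

theorem eval_pos_of_monic_of_forall_ge_ne_zero {p : ℝ[X]} (hp : p.Monic) {x₀ : ℝ}
    (h : ∀ x, x₀ ≤ x → p.eval x ≠ 0) : 0 < p.eval x₀ := by
  by_contra hneg
  have hlt : p.eval x₀ < 0 := lt_of_le_of_ne (not_lt.1 hneg) (h x₀ le_rfl)
  have hdeg : 0 < p.degree := by
    by_contra hd
    rw [not_lt, hp.degree_le_zero_iff_eq_one] at hd
    rw [hd, eval_one] at hlt
    exact hlt.not_gt one_pos
  have ht := tendsto_atTop_of_leadingCoeff_nonneg p hdeg (hp.leadingCoeff ▸ zero_le_one)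
  obtain ⟨x₁, hx₁, hpos⟩ := ((Filter.eventually_ge_atTop x₀).and
    (ht.eventually_gt_atTop 0)).exists
  obtain ⟨c, hc, hc0⟩ := intermediate_value_Icc hx₁ p.continuous.continuousOn ⟨hlt.le, hpos.le⟩
  exact h c hc.1 hc0

theorem even_natDegree_of_monic_of_forall_eval_ne_zero {p : ℝ[X]} (hp : p.Monic)
    (h : ∀ x, p.eval x ≠ 0) : Even p.natDegree := by
  by_contra hodd
  rw [Nat.not_even_iff_odd] at hodd
  have hpos := eval_pos_of_monic_of_forall_ge_ne_zero hp (x₀ := 0) fun x _ => h x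
  have hm : (-p.comp (-X)).Monic := by
    rw [Monic, leadingCoeff_neg, leadingCoeff_comp (by simp), hp.leadingCoeff]
    simp [hodd.neg_one_pow]
  have hneg := eval_pos_of_monic_of_forall_ge_ne_zero hm (x₀ := 0) fun x _ => by
    simpa [eval_comp] using h (-x)
  rw [eval_neg, eval_comp, eval_neg, eval_X, neg_zero] at hneg
  linarith

-- Splitting off the largest root `x₀` reverses the sign of the derivative at the other roots, and
-- the derivative at `x₀` is positive.
theorem sum_sign_derivative_roots {p : ℝ[X]} (hp : p.Monic) (hroots : p.roots.Nodup) :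
    ∑ x ∈ p.roots.toFinset, (SignType.sign (p.derivative.eval x) : ℤ) =
      (p.natDegree % 2 : ℕ) := by
  induction hN : p.natDegree generalizing p with
  | zero => simp [hp.natDegree_eq_zero.1 hN]
  | succ N ih =>
    rcases p.roots.toFinset.eq_empty_or_nonempty with hempty | hne
    · have heven := even_natDegree_of_monic_of_forall_eval_ne_zero hp fun x hx => by
        simpa [hempty] using (Multiset.mem_toFinset (s := p.roots)).2 (mem_roots hp.ne_zero |>.2 hx)
      rw [hempty, Finset.sum_empty, ← hN, Nat.even_iff.1 heven, Nat.cast_zero]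
    obtain ⟨x₀, hx₀, hmax⟩ := p.roots.toFinset.exists_max_image id hne
    obtain ⟨g, rfl⟩ := dvd_iff_isRoot.2 (isRoot_of_mem_roots (Multiset.mem_toFinset.1 hx₀))
    have hg : g.Monic := (monic_X_sub_C x₀).of_mul_monic_left hp
    have hdeg : g.natDegree = N := by
      rw [(monic_X_sub_C x₀).natDegree_mul hg, natDegree_X_sub_C] at hN
      omega
    rw [roots_mul hp.ne_zero, roots_X_sub_C, Multiset.singleton_add] at hroots hmax ⊢
    obtain ⟨hx₀g, hnodup⟩ := Multiset.nodup_cons.1 hroots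
    rw [Multiset.toFinset_cons, Finset.sum_insert (by simpa using hx₀g)]
    have hlt : ∀ x ∈ g.roots, x < x₀ := fun x hx =>
      (hmax x (by simp [hx])).lt_of_ne fun h : x = x₀ => hx₀g (h ▸ hx)
    have hpos : 0 < g.eval x₀ := eval_pos_of_monic_of_forall_ge_ne_zero hg fun x hx h0 =>
      (hlt x ((mem_roots hg.ne_zero).2 h0)).not_ge hx
    have hder : ∀ x, (derivative ((X - C x₀) * g)).eval x =
        g.eval x + (x - x₀) * g.derivative.eval x := fun x => by simp [derivative_mul]
    have hflip : ∀ x ∈ g.roots.toFinset,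
        (SignType.sign ((derivative ((X - C x₀) * g)).eval x) : ℤ) =
          -(SignType.sign (g.derivative.eval x) : ℤ) := fun x hx => by
      have hx := Multiset.mem_toFinset.1 hx
      rw [hder, isRoot_of_mem_roots hx, zero_add, sign_mul, sign_neg (sub_neg.2 (hlt x hx))]
      simp
    rw [Finset.sum_congr rfl hflip, Finset.sum_neg_distrib, ih hg hnodup hdeg, hder, sub_self,
      zero_mul, add_zero, sign_pos hpos, SignType.coe_one]
    omega

theorem aeval_ofReal_eq_zero_iff (p : ℝ[X]) (x : ℝ) : aeval (x : ℂ) p = 0 ↔ p.IsRoot x := by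
  rw [← Complex.coe_algebraMap, aeval_algebraMap_eq_zero_iff, coe_aeval_eq_eval, IsRoot.def]

theorem card_roots_toFinset_add_card_nonreal {p : ℝ[X]} (hp : p.Separable) :
    p.roots.toFinset.card + {β ∈ (p.aroots ℂ).toFinset | β.im ≠ 0}.card = p.natDegree := by
  have hcard : (p.aroots ℂ).toFinset.card = p.natDegree := by
    rw [Multiset.toFinset_card_of_nodup (nodup_roots hp.map), IsAlgClosed.card_aroots_eq_natDegree]
  have hreal : p.roots.toFinset.card = {β ∈ (p.aroots ℂ).toFinset | β.im = 0}.card := by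
    rw [← Finset.card_map ⟨((↑) : ℝ → ℂ), Complex.ofReal_injective⟩]
    congr 1
    ext β
    simp only [Finset.mem_map, Multiset.mem_toFinset, mem_roots hp.ne_zero, Finset.mem_filter,
      mem_aroots, ne_eq, hp.ne_zero, not_false_eq_true, true_and, Function.Embedding.coeFn_mk]
    constructor
    · rintro ⟨x, hx, rfl⟩
      exact ⟨(aeval_ofReal_eq_zero_iff p x).2 hx, Complex.ofReal_im x⟩
    · rintro ⟨hβ, him⟩
      obtain ⟨x, rfl⟩ : ∃ x : ℝ, (x : ℂ) = β := ⟨β.re, Complex.ext rfl him.symm⟩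
      exact ⟨x, (aeval_ofReal_eq_zero_iff p x).1 hβ, rfl⟩
  rw [hreal, Finset.card_filter_add_card_filter_not, hcard]

theorem card_nonreal_sub_sum_sign {p : ℝ[X]} (hp : p.Monic) (hsep : p.Separable) :
    ({β ∈ (p.aroots ℂ).toFinset | β.im ≠ 0}.card : ℤ) - ∑ v ∈ p.roots.toFinset.offDiag,
      (SignType.sign (p.derivative.eval v.1) * SignType.sign (p.derivative.eval v.2) : ℤ) =
      2 * (p.natDegree / 2 : ℕ) := by
  have hsum := sum_sign_derivative_roots hp (nodup_roots hsep)
  have hcard := card_roots_toFinset_add_card_nonreal hsep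
  set S := p.roots.toFinset with hS
  set ε : ℝ → ℤ := fun x => (SignType.sign (p.derivative.eval x) : ℤ) with hε
  have hdiag : ∑ v ∈ S.diag, ε v.1 * ε v.2 = S.card := by
    rw [Finset.sum_diag, Finset.card_eq_sum_ones, Nat.cast_sum]
    refine Finset.sum_congr rfl fun x hx => ?_
    have hne : p.derivative.eval x ≠ 0 := by
      simpa using hsep.aeval_derivative_ne_zero (x := x) (by simpa [hS, hp.ne_zero] using hx)
    rcases hne.lt_or_gt with h | h <;> simp [hε, h]
  have hsq : ∑ v ∈ S.diag, ε v.1 * ε v.2 + ∑ v ∈ S.offDiag, ε v.1 * ε v.2 =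
      (∑ x ∈ S, ε x) ^ 2 := by
    rw [← Finset.sum_union (Finset.disjoint_diag_offDiag S), Finset.diag_union_offDiag,
      Finset.sum_product, sq, Finset.sum_mul_sum]
  have hmod : ((p.natDegree % 2 : ℕ) : ℤ) ^ 2 = (p.natDegree % 2 : ℕ) := by
    rcases Nat.mod_two_eq_zero_or_one p.natDegree with h | h <;> rw [h] <;> rfl
  rw [hdiag, hsum, hmod] at hsq
  change _ - ∑ v ∈ S.offDiag, ε v.1 * ε v.2 = _
  omega

end SignCount

section Fibers

variable {n : ℕ}

theorem bijOn_leftPart_preimage_paramMulMap {𝕜 : Type*} [CommRing 𝕜] [Nontrivial 𝕜] {m : ℕ}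
    (ρ : (Fin m → 𝕜) → Fin m → 𝕜) (y : Fin (m + n) → 𝕜) :
    Set.BijOn leftPart (paramMulMap ρ ⁻¹' {y}) {v | monicPoly (ρ v) ∣ monicPoly y} := by
  have hmem : ∀ z, z ∈ paramMulMap ρ ⁻¹' {y} ↔
      monicPoly (ρ (leftPart z)) * monicPoly (rightPart z) = monicPoly y := fun z => by
    rw [Set.mem_preimage, Set.mem_singleton_iff, ← monicPoly_paramMulMap,
      monicPoly_injective.eq_iff]
  refine ⟨fun z hz => ⟨_, ((hmem z).1 hz).symm⟩, fun z hz z' hz' h => ?_, fun v ⟨g, hg⟩ => ?_⟩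
  · rw [hmem] at hz hz'
    rw [← hz', h] at hz
    rw [← append_leftPart_rightPart z, ← append_leftPart_rightPart z', h,
      monicPoly_injective ((monic_monicPoly _).isRegular.left hz)]
  · have hm : g.Monic := (monic_monicPoly (ρ v)).of_mul_monic_left (hg ▸ monic_monicPoly y)
    have hd : g.natDegree = n := by
      have := congrArg natDegree hg
      rw [(monic_monicPoly _).natDegree_mul hm, natDegree_monicPoly, natDegree_monicPoly] at this
      omega
    refine ⟨Fin.append v (fun i => g.coeff i), (hmem _).2 ?_, leftPart_append _ _⟩
    rw [leftPart_append, rightPart_append, monicPoly_coeff_eq_self hm hd, hg]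

theorem mul_monicPoly_rightPart {𝕜 : Type*} [CommRing 𝕜] {m : ℕ}
    {ρ : (Fin m → 𝕜) → Fin m → 𝕜} {z y : Fin (m + n) → 𝕜} (hz : paramMulMap ρ z = y) :
    monicPoly (ρ (leftPart z)) * monicPoly (rightPart z) = monicPoly y := by
  rw [← monicPoly_paramMulMap, hz]

theorem not_separable_X_sub_C_mul_self (x : ℝ) : ¬ ((X - C x) * (X - C x)).Separable :=
  fun h => not_isUnit_X_sub_C x (isCoprime_self.1 h.isCoprime)

theorem bijOn_setOf_realPair_dvd {p : ℝ[X]} (hp : p.Separable) :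
    Set.BijOn (fun v : Fin 2 → ℝ => (v 0, v 1)) {v | monicPoly (realPair v) ∣ p}
      p.roots.toFinset.offDiag := by
  have hroot : ∀ x, x ∈ p.roots.toFinset ↔ X - C x ∣ p := fun x => by
    rw [Multiset.mem_toFinset, mem_roots hp.ne_zero, dvd_iff_isRoot]
  refine ⟨fun v hv => ?_, fun v _ w _ h => ?_, fun ⟨x, y⟩ h => ⟨![x, y], ?_, rfl⟩⟩
  · rw [Set.mem_ofPred_eq, monicPoly_realPair] at hv
    rw [Finset.mem_coe, Finset.mem_offDiag, hroot, hroot]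
    refine ⟨(dvd_mul_right _ _).trans hv, (dvd_mul_left _ _).trans hv, fun h => ?_⟩
    rw [show v 0 = v 1 from h] at hv
    exact not_separable_X_sub_C_mul_self _ (hp.of_dvd hv)
  · ext i
    fin_cases i
    exacts [congrArg Prod.fst h, congrArg Prod.snd h]
  · obtain ⟨hx, hy, hxy⟩ := Finset.mem_offDiag.1 h
    rw [hroot] at hx hy
    rw [Set.mem_ofPred_eq, monicPoly_realPair]
    exact (isCoprime_X_sub_C_of_isUnit_sub (sub_ne_zero.2 hxy).isUnit).mul_dvd hx hy

theorem conjPair_dvd_iff {p : ℝ[X]} {v : Fin 2 → ℝ} (hv : v 1 ≠ 0) :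
    monicPoly (conjPair v) ∣ p ↔ aeval (⟨v 0, v 1⟩ : ℂ) p = 0 := by
  constructor
  · rintro ⟨g, rfl⟩
    rw [← eval_map_algebraMap, Polynomial.map_mul, map_monicPoly_conjPair]
    simp
  · intro h
    have hdvd := quadratic_dvd_of_aeval_eq_zero_im_ne_zero p h hv
    rwa [← Complex.normSq_eq_norm_sq, Complex.normSq_mk, ← sq, ← sq, ← monicPoly_conjPair] at hdvd

theorem bijOn_setOf_conjPair_dvd {p : ℝ[X]} (hp : p.Separable) :
    Set.BijOn (fun v : Fin 2 → ℝ => (⟨v 0, v 1⟩ : ℂ)) {v | monicPoly (conjPair v) ∣ p}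
      ({β ∈ (p.aroots ℂ).toFinset | β.im ≠ 0} : Finset ℂ) := by
  refine ⟨fun v hv => ?_, fun v _ w _ h => ?_, fun β hβ => ⟨![β.re, β.im], ?_, rfl⟩⟩
  · have him : v 1 ≠ 0 := fun h => by
      refine not_separable_X_sub_C_mul_self (v 0) (hp.of_dvd ?_)
      have hsq : monicPoly (conjPair v) = (X - C (v 0)) * (X - C (v 0)) := by
        simp only [monicPoly_conjPair, h, C_mul, C_add, C_pow, C_0, C_ofNat]
        ring
      rwa [← hsq]
    simpa [hp.ne_zero, him] using (conjPair_dvd_iff him).1 hv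
  · ext i
    fin_cases i
    exacts [congrArg Complex.re h, congrArg Complex.im h]
  · simp only [Finset.coe_filter, Multiset.mem_toFinset, mem_aroots, Set.mem_ofPred_eq] at hβ
    exact (conjPair_dvd_iff hβ.2).2 hβ.1.2

theorem encard_preimage_realPair_le {y : Fin (2 + n) → ℝ} (hy : (monicPoly y).Separable) :
    (paramMulMap realPair ⁻¹' {y}).encard ≤ ((2 + n) * (2 + n) : ℕ) := by
  have hbij := (bijOn_setOf_realPair_dvd hy).comp (bijOn_leftPart_preimage_paramMulMap _ y)
  have hcard : (monicPoly y).roots.toFinset.card ≤ 2 + n :=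
    (Multiset.toFinset_card_le _).trans ((card_roots' _).trans (natDegree_monicPoly y).le)
  rw [← hbij.injOn.encard_image, hbij.image_eq, Set.encard_coe_eq_coe_finsetCard, Nat.cast_le,
    Finset.offDiag_card]
  exact (Nat.sub_le _ _).trans (Nat.mul_le_mul hcard hcard)

theorem encard_preimage_conjPair_le {y : Fin (2 + n) → ℝ} (hy : (monicPoly y).Separable) :
    (paramMulMap conjPair ⁻¹' {y}).encard ≤ (2 + n : ℕ) := by
  have hbij := (bijOn_setOf_conjPair_dvd hy).comp (bijOn_leftPart_preimage_paramMulMap _ y)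
  rw [← hbij.injOn.encard_image, hbij.image_eq, Set.encard_coe_eq_coe_finsetCard, Nat.cast_le]
  exact (Nat.le_add_left _ _).trans
    ((card_roots_toFinset_add_card_nonreal hy).trans (natDegree_monicPoly y)).le

theorem eval_derivative_mul_eval_derivative (x y : ℝ) (g : ℝ[X]) :
    ((X - C x) * (X - C y) * g).derivative.eval x *
      ((X - C x) * (X - C y) * g).derivative.eval y =
      -((x - y) ^ 2 * (g.eval x * g.eval y)) := by
  simp only [derivative_mul, derivative_sub, derivative_X, derivative_C, eval_add, eval_mul,
    eval_sub, eval_X, eval_C, eval_one, eval_zero]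
  ring

theorem signedFiberCount_realPair {y : Fin (2 + n) → ℝ} (hy : (monicPoly y).Separable) :
    signedFiberCount (paramMulMap realPair) realJac y =
      -∑ v ∈ (monicPoly y).roots.toFinset.offDiag,
        (SignType.sign ((monicPoly y).derivative.eval v.1) *
          SignType.sign ((monicPoly y).derivative.eval v.2) : ℤ) := by
  have hbij := (bijOn_setOf_realPair_dvd hy).comp (bijOn_leftPart_preimage_paramMulMap _ y)
  rw [← Finset.sum_neg_distrib, ← finsum_mem_coe_finset, signedFiberCount]
  refine finsum_mem_eq_of_bijOn _ hbij fun z hz => ?_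
  have hne : leftPart z 0 ≠ leftPart z 1 := (Finset.mem_offDiag.1 (hbij.mapsTo hz)).2.2
  have hder := eval_derivative_mul_eval_derivative (leftPart z 0) (leftPart z 1)
    (monicPoly (rightPart z))
  rw [← monicPoly_realPair, mul_monicPoly_rightPart hz] at hder
  simp only [Function.comp_apply]
  rw [← SignType.coe_mul, ← sign_mul, hder, Left.sign_neg, sign_mul,
    sign_pos (sq_pos_of_ne_zero (sub_ne_zero.2 hne)), realJac, sign_mul,
    sign_pos (abs_pos.2 (sub_ne_zero.2 hne.symm))]
  simp

theorem conjJac_eq_zero_iff {z : Fin (2 + n) → ℝ} : conjJac z = 0 ↔ leftPart z 1 = 0 ∨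
    aeval (⟨leftPart z 0, leftPart z 1⟩ : ℂ) (monicPoly (rightPart z)) = 0 := by
  simp [conjJac]

theorem aeval_derivative_conjPair_mul (v : Fin 2 → ℝ) (g : ℝ[X]) :
    aeval (⟨v 0, v 1⟩ : ℂ) (monicPoly (conjPair v) * g).derivative =
      2 * v 1 * Complex.I * aeval (⟨v 0, v 1⟩ : ℂ) g := by
  rw [← eval_map_algebraMap, ← derivative_map, Polynomial.map_mul, map_monicPoly_conjPair,
    ← eval_map_algebraMap, Complex.mk_eq_add_mul_I]
  simp only [derivative_mul, derivative_sub, derivative_X, derivative_C, eval_add, eval_mul,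
    eval_sub, eval_X, eval_C, eval_one, eval_zero, map_add, map_mul, Complex.conj_ofReal,
    Complex.conj_I]
  ring

theorem signedFiberCount_conjPair {y : Fin (2 + n) → ℝ} (hy : (monicPoly y).Separable) :
    signedFiberCount (paramMulMap conjPair) conjJac y =
      {β ∈ ((monicPoly y).aroots ℂ).toFinset | β.im ≠ 0}.card := by
  have hbij := (bijOn_setOf_conjPair_dvd hy).comp (bijOn_leftPart_preimage_paramMulMap _ y)
  rw [Finset.card_eq_sum_ones, Nat.cast_sum, ← finsum_mem_coe_finset, signedFiberCount]
  refine finsum_mem_eq_of_bijOn _ hbij fun z hz => ?_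
  obtain ⟨hroot, him⟩ := Finset.mem_filter.1 (hbij.mapsTo hz)
  have hder := hy.aeval_derivative_ne_zero ((mem_aroots.1 (Multiset.mem_toFinset.1 hroot)).2)
  rw [Function.comp_apply, ← mul_monicPoly_rightPart hz, aeval_derivative_conjPair_mul] at hder
  have hJ : conjJac z ≠ 0 := fun h => (conjJac_eq_zero_iff.1 h).elim him (right_ne_zero_of_mul hder)
  rw [sign_pos ((conjJac_nonneg z).lt_of_ne' hJ)]
  simp

theorem exists_leftPart_eq_of_dvd {𝕜 : Type*} [CommRing 𝕜] [Nontrivial 𝕜] {m : ℕ}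
    {ρ : (Fin m → 𝕜) → Fin m → 𝕜} {v : Fin m → 𝕜} {y : Fin (m + n) → 𝕜}
    (h : monicPoly (ρ v) ∣ monicPoly y) : ∃ z, paramMulMap ρ z = y ∧ leftPart z = v :=
  (bijOn_leftPart_preimage_paramMulMap ρ y).surjOn h

theorem mem_image_of_not_separable {y : Fin (2 + n) → ℝ} (hy : ¬ (monicPoly y).Separable) :
    y ∈ paramMulMap realPair '' {z | realJac z = 0} ∪
      paramMulMap conjPair '' {z | conjJac z = 0} := by
  obtain ⟨β, hβ, hβ'⟩ : ∃ β : ℂ, aeval β (monicPoly y) = 0 ∧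
      aeval β (monicPoly y).derivative = 0 := by
    by_contra! h
    exact hy ((isCoprime_iff_aeval_ne_zero_of_isAlgClosed ℝ ℂ _ _).2 fun β => or_iff_not_imp_left.2
      fun h0 => h β (not_not.1 h0))
  by_cases him : β.im = 0
  · obtain ⟨x, rfl⟩ : ∃ x : ℝ, (x : ℂ) = β := ⟨β.re, Complex.ext rfl him.symm⟩
    rw [aeval_ofReal_eq_zero_iff] at hβ hβ'
    have hdvd : monicPoly (realPair ![x, x]) ∣ monicPoly y := by
      have hmult := (one_lt_rootMultiplicity_iff_isRoot (monic_monicPoly y).ne_zero).2 ⟨hβ, hβ'⟩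
      simpa [monicPoly_realPair, sq] using
        (le_rootMultiplicity_iff (monic_monicPoly y).ne_zero).1 hmult
    obtain ⟨z, hz, hzx⟩ := exists_leftPart_eq_of_dvd hdvd
    exact Or.inl ⟨z, by simp [realJac, hzx], hz⟩
  · obtain ⟨z, hz, hzβ⟩ := exists_leftPart_eq_of_dvd
      ((conjPair_dvd_iff (v := ![β.re, β.im]) him).2 hβ)
    refine Or.inr ⟨z, ?_, hz⟩
    have hβz : (⟨leftPart z 0, leftPart z 1⟩ : ℂ) = β := by simp [hzβ]
    rw [← hβz, ← mul_monicPoly_rightPart hz, aeval_derivative_conjPair_mul] at hβ'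
    simpa [conjJac_eq_zero_iff] using hβ'

theorem ae_separable_monicPoly : ∀ᵐ y : Fin (2 + n) → ℝ, (monicPoly y).Separable := by
  have hreal : volume (paramMulMap realPair '' {z : Fin (2 + n) → ℝ | realJac z = 0}) = 0 :=
    addHaar_image_eq_zero_of_det_fderivWithin_eq_zero volume
      (fun z _ => (hasFDerivAt_paramMulMap (hasFDerivAt_realPair _)).hasFDerivWithinAt)
      fun z hz => by rw [← abs_eq_zero, abs_det_realPair, show realJac z = 0 from hz, abs_zero]
  have hconj : volume (paramMulMap conjPair '' {z : Fin (2 + n) → ℝ | conjJac z = 0}) = 0 :=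
    addHaar_image_eq_zero_of_det_fderivWithin_eq_zero volume
      (fun z _ => (hasFDerivAt_paramMulMap (hasFDerivAt_conjPair _)).hasFDerivWithinAt)
      fun z hz => by rw [← abs_eq_zero, abs_det_conjPair, show conjJac z = 0 from hz, abs_zero]
  exact measure_mono_null (fun y hy => mem_image_of_not_separable hy)
    (measure_union_null hreal hconj)

end Fibers

section SignedArea

variable {n : ℕ}

@[fun_prop]
theorem measurable_leftPart {α : Type*} [MeasurableSpace α] {m : ℕ} :
    Measurable (leftPart : (Fin (m + n) → α) → Fin m → α) :=
  measurable_pi_lambda _ fun _ => measurable_pi_apply _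

@[fun_prop]
theorem measurable_rightPart {α : Type*} [MeasurableSpace α] {m : ℕ} :
    Measurable (rightPart : (Fin (m + n) → α) → Fin n → α) :=
  measurable_pi_lambda _ fun _ => measurable_pi_apply _

theorem measurable_aeval_monicPoly {A : Type*} [CommRing A] [MeasurableSpace A] [Algebra ℝ A]
    [MeasurableAdd₂ A] [MeasurableMul₂ A] (hmap : Measurable (algebraMap ℝ A)) {γ : Type*}
    [MeasurableSpace γ] {b : γ → Fin n → ℝ} {a : γ → A} (hb : Measurable b) (ha : Measurable a) :
    Measurable fun x => aeval (a x) (monicPoly (b x)) := by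
  simp only [monicPoly, lowPoly_apply, map_add, map_pow, map_sum, map_mul, aeval_X, aeval_C]
  fun_prop

theorem measurable_realJac : Measurable (realJac : (Fin (2 + n) → ℝ) → ℝ) := by
  have heval : ∀ i : Fin 2, Measurable fun z : Fin (2 + n) → ℝ =>
      (monicPoly (rightPart z)).eval (leftPart z i) := fun i =>
    measurable_aeval_monicPoly measurable_id (by fun_prop) (by fun_prop)
  unfold realJac
  fun_prop

theorem measurable_conjJac : Measurable (conjJac : (Fin (2 + n) → ℝ) → ℝ) := by
  have haeval : Measurable fun z : Fin (2 + n) → ℝ =>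
      aeval (⟨leftPart z 0, leftPart z 1⟩ : ℂ) (monicPoly (rightPart z)) := by
    simp only [Complex.mk_eq_add_mul_I]
    exact measurable_aeval_monicPoly Complex.measurable_ofReal (by fun_prop) (by fun_prop)
  unfold conjJac
  fun_prop

variable {F : Type*} [NormedAddCommGroup F] [NormedSpace ℝ F] {h : (Fin (2 + n) → ℝ) → F}

theorem integrable_realJac_smul (hh : Integrable h) :
    Integrable fun z => realJac z • h (paramMulMap realPair z) :=
  integrable_smul_comp volume (fun _ => hasFDerivAt_paramMulMap (hasFDerivAt_realPair _))
    measurable_realJac abs_det_realPair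
    (ae_separable_monicPoly.mono fun _ => encard_preimage_realPair_le) hh

theorem integrable_conjJac_smul (hh : Integrable h) :
    Integrable fun z => conjJac z • h (paramMulMap conjPair z) :=
  integrable_smul_comp volume (fun _ => hasFDerivAt_paramMulMap (hasFDerivAt_conjPair _))
    measurable_conjJac abs_det_conjPair
    (ae_separable_monicPoly.mono fun _ => encard_preimage_conjPair_le) hh

theorem integral_realJac_smul_add_integral_conjJac_smul (hh : Integrable h) :
    (∫ z, realJac z • h (paramMulMap realPair z)) + ∫ z, conjJac z • h (paramMulMap conjPair z) =
      ((2 * ((2 + n) / 2) : ℕ) : ℝ) • ∫ y, h y := by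
  have hreal := ae_separable_monicPoly.mono fun _ => encard_preimage_realPair_le (n := n)
  have hconj := ae_separable_monicPoly.mono fun _ => encard_preimage_conjPair_le (n := n)
  have hreal' : ∀ z : Fin (2 + n) → ℝ, HasFDerivAt (paramMulMap realPair) _ z := fun _ =>
    hasFDerivAt_paramMulMap (hasFDerivAt_realPair _)
  have hconj' : ∀ z : Fin (2 + n) → ℝ, HasFDerivAt (paramMulMap conjPair) _ z := fun _ =>
    hasFDerivAt_paramMulMap (hasFDerivAt_conjPair _)
  rw [integral_smul_comp volume hreal' measurable_realJac abs_det_realPair hreal hh,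
    integral_smul_comp volume hconj' measurable_conjJac abs_det_conjPair hconj hh,
    ← integral_add
      (integrable_signedFiberCount_smul _ hreal' measurable_realJac abs_det_realPair hreal hh)
      (integrable_signedFiberCount_smul _ hconj' measurable_conjJac abs_det_conjPair hconj hh),
    ← integral_smul]
  refine integral_congr_ae (ae_separable_monicPoly.mono fun y hy => ?_)
  have hcard := card_nonreal_sub_sum_sign (monic_monicPoly y) hy
  rw [natDegree_monicPoly] at hcard
  simp only [← add_smul]
  rw [signedFiberCount_realPair hy, signedFiberCount_conjPair hy]
  congr 1
  rw [← Int.cast_natCast (R := ℝ) (2 * _), ← Int.cast_add]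
  congr 1
  push_cast at hcard ⊢
  linarith

end SignedArea

section PolyWeight

variable {Φ : ℂ[X] → ℝ} {s : ℂ} {n : ℕ}

/-- The weight `Φ(f)^{-s}` of a polynomial `f`. -/
def polyWeight (Φ : ℂ[X] → ℝ) (s : ℂ) (f : ℂ[X]) : ℂ := (Φ f : ℂ) ^ (-s)

theorem monicPoly_eq_lowPoly_snoc {R : Type*} [CommRing R] (b : Fin n → R) :
    monicPoly b = lowPoly (n + 1) (Fin.snoc b (1 : R) : Fin (n + 1) → R) := by
  rw [lowPoly_apply, Fin.sum_univ_castSucc, monicPoly, lowPoly_apply]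
  simp [add_comm]

theorem monicPoly_const_neg {R : Type*} [CommRing R] (γ : R) :
    monicPoly (fun _ : Fin 1 => -γ) = X - C γ := by
  simp [monicPoly, lowPoly_apply, sub_eq_add_neg]

namespace IsMultiplicativeDistance

theorem pos_of_ne_zero (hΦ : IsMultiplicativeDistance Φ) {f : ℂ[X]} (hf : f ≠ 0) : 0 < Φ f :=
  (hΦ.nonneg f).lt_of_ne' fun h => hf ((hΦ.eq_zero_iff f).1 h)

theorem map_one (hΦ : IsMultiplicativeDistance Φ) : Φ 1 = 1 :=
  mul_right_cancel₀ (hΦ.pos_of_ne_zero one_ne_zero).ne' (by rw [← hΦ.map_mul, one_mul, one_mul])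

theorem exists_mul_norm_le_lowPoly (hΦ : IsMultiplicativeDistance Φ) (d : ℕ) :
    ∃ κ : ℝ, 0 < κ ∧ ∀ c : Fin d → ℂ, κ * ‖c‖ ≤ Φ (lowPoly d c) := by
  have hcont : Continuous fun c : Fin d → ℂ => Φ (lowPoly d c) := by
    simpa only [lowPoly_apply] using hΦ.continuous_coeff d
  have hpos : ∀ c ∈ Metric.sphere (0 : Fin d → ℂ) 1, 0 < Φ (lowPoly d c) := fun c hc =>
    hΦ.pos_of_ne_zero fun h0 => by
      have hc0 : c = 0 := funext fun i => by
        simpa [lowPoly_coeff] using congrArg (fun p : ℂ[X] => p.coeff i) h0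
      simp [hc0] at hc
  obtain ⟨κ, hκ, hmin⟩ :=
    (isCompact_sphere (0 : Fin d → ℂ) 1).exists_forall_le' hcont.continuousOn hpos
  refine ⟨κ, hκ, fun c => ?_⟩
  rcases eq_or_ne c 0 with rfl | hc
  · simpa using hΦ.nonneg _
  · have hunit := hmin ((‖c‖ : ℂ)⁻¹ • c) (by simp [norm_smul, hc])
    rwa [_root_.map_smul, hΦ.map_smul, norm_inv, Complex.norm_real, norm_norm, inv_mul_eq_div,
      le_div_iff₀ (norm_pos_iff.2 hc)] at hunit

theorem exists_mul_one_add_norm_le_monicPoly (hΦ : IsMultiplicativeDistance Φ) (n : ℕ) :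
    ∃ κ : ℝ, 0 < κ ∧ ∀ b : Fin n → ℂ, κ * (1 + ‖b‖) ≤ Φ (monicPoly b) := by
  obtain ⟨κ, hκ, h⟩ := hΦ.exists_mul_norm_le_lowPoly (n + 1)
  refine ⟨κ / 2, by positivity, fun b => ?_⟩
  rw [monicPoly_eq_lowPoly_snoc]
  refine le_trans ?_ (h _)
  set c : Fin (n + 1) → ℂ := Fin.snoc b 1 with hc
  have hlast : 1 ≤ ‖c‖ := by simpa [hc] using norm_le_pi_norm c (Fin.last n)
  have hinit : ‖b‖ ≤ ‖c‖ := (pi_norm_le_iff_of_nonneg (norm_nonneg _)).2 fun i => by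
    simpa [hc] using norm_le_pi_norm c i.castSucc
  nlinarith

theorem continuous_monicPoly (hΦ : IsMultiplicativeDistance Φ) :
    Continuous fun b : Fin n → ℂ => Φ (monicPoly b) := by
  simp only [monicPoly_eq_lowPoly_snoc, lowPoly_apply]
  exact (hΦ.continuous_coeff (n + 1)).comp
    (Continuous.finSnoc (A := fun _ => ℂ) continuous_id continuous_const)

theorem polyWeight_mul (hΦ : IsMultiplicativeDistance Φ) (f g : ℂ[X]) :
    polyWeight Φ s (f * g) = polyWeight Φ s f * polyWeight Φ s g := by
  simp only [polyWeight, hΦ.map_mul, Complex.ofReal_mul,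
    Complex.mul_cpow_ofReal_nonneg (hΦ.nonneg f) (hΦ.nonneg g)]

theorem polyWeight_one (hΦ : IsMultiplicativeDistance Φ) : polyWeight Φ s 1 = 1 := by
  rw [polyWeight, hΦ.map_one, Complex.ofReal_one, Complex.one_cpow]

theorem continuous_polyWeight (hΦ : IsMultiplicativeDistance Φ) :
    Continuous fun b : Fin n → ℂ => polyWeight Φ s (monicPoly b) :=
  (Complex.continuous_ofReal.comp hΦ.continuous_monicPoly).cpow continuous_const fun b =>
    Complex.ofReal_mem_slitPlane.2 (hΦ.pos_of_ne_zero (monic_monicPoly b).ne_zero)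

theorem exists_norm_polyWeight_le (hΦ : IsMultiplicativeDistance Φ) (n : ℕ) (hs : 0 ≤ s.re) :
    ∃ K : ℝ, 0 ≤ K ∧ ∀ b : Fin n → ℂ,
      ‖polyWeight Φ s (monicPoly b)‖ ≤ K * (1 + ‖b‖) ^ (-s.re) := by
  obtain ⟨κ, hκ, h⟩ := hΦ.exists_mul_one_add_norm_le_monicPoly n
  refine ⟨κ ^ (-s.re), by positivity, fun b => ?_⟩
  rw [polyWeight, Complex.norm_cpow_eq_rpow_re_of_pos
    (hΦ.pos_of_ne_zero (monic_monicPoly b).ne_zero), Complex.neg_re,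
    ← Real.mul_rpow hκ.le (by positivity)]
  exact Real.rpow_le_rpow_of_nonpos (by positivity) (h b) (neg_nonpos.2 hs)

end IsMultiplicativeDistance

end PolyWeight

section RootWeight

variable {Φ : ℂ[X] → ℝ} {s : ℂ} {P Q : ℂ[X]}

theorem exists_norm_eval_le (P : ℂ[X]) :
    ∃ K : ℝ, 0 ≤ K ∧ ∀ γ : ℂ, ‖P.eval γ‖ ≤ K * (1 + ‖γ‖) ^ P.natDegree := by
  refine ⟨∑ i ∈ Finset.range (P.natDegree + 1), ‖P.coeff i‖, by positivity, fun γ => ?_⟩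
  rw [eval_eq_sum_range, Finset.sum_mul]
  refine (norm_sum_le _ _).trans (Finset.sum_le_sum fun i hi => ?_)
  rw [norm_mul, norm_pow]
  gcongr
  exact (pow_le_pow_left₀ (norm_nonneg γ) (by linarith) i).trans
    (pow_le_pow_right₀ (by linarith [norm_nonneg γ]) (Finset.mem_range_succ_iff.1 hi))

theorem measurable_real_sign : Measurable Real.sign :=
  .ite measurableSet_Iio measurable_const (.ite measurableSet_Ioi measurable_const measurable_const)

theorem norm_real_sign_le_one (x : ℝ) : ‖(Real.sign x : ℂ)‖ ≤ 1 := by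
  rcases Real.sign_apply_eq x with h | h | h <;> simp [h]

theorem zero_le_re_of_natDegree_add_one_lt (hP : (P.natDegree : ℝ) + 1 < s.re) : 0 ≤ s.re := by
  linarith [P.natDegree.cast_nonneg (α := ℝ)]

theorem rootWeight_eq_polyWeight (Φ : ℂ[X] → ℝ) (s γ : ℂ) :
    rootWeight Φ s γ = polyWeight Φ s (X - C γ) := rfl

namespace IsMultiplicativeDistance

theorem continuous_rootWeight (hΦ : IsMultiplicativeDistance Φ) : Continuous (rootWeight Φ s) := by
  have h : rootWeight Φ s = fun γ => polyWeight Φ s (monicPoly (fun _ : Fin 1 => -γ)) :=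
    funext fun γ => by rw [monicPoly_const_neg, rootWeight_eq_polyWeight]
  rw [h]
  exact hΦ.continuous_polyWeight.comp (continuous_pi fun _ => continuous_neg)

theorem exists_norm_rootWeight_mul_eval_le (hΦ : IsMultiplicativeDistance Φ) (hs : 0 ≤ s.re)
    (P : ℂ[X]) : ∃ K : ℝ, 0 ≤ K ∧ ∀ γ : ℂ,
      ‖rootWeight Φ s γ * P.eval γ‖ ≤ K * (1 + ‖γ‖) ^ (-(s.re - P.natDegree)) := by
  obtain ⟨K, hK, hweight⟩ := hΦ.exists_norm_polyWeight_le 1 hs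
  obtain ⟨K', hK', heval⟩ := exists_norm_eval_le P
  refine ⟨K * K', by positivity, fun γ => ?_⟩
  have hroot : ‖rootWeight Φ s γ‖ ≤ K * (1 + ‖γ‖) ^ (-s.re) := by
    simpa [monicPoly_const_neg, rootWeight_eq_polyWeight] using hweight fun _ => -γ
  calc ‖rootWeight Φ s γ * P.eval γ‖
      ≤ K * (1 + ‖γ‖) ^ (-s.re) * (K' * (1 + ‖γ‖) ^ P.natDegree) := by
        rw [norm_mul]
        exact mul_le_mul hroot (heval γ) (norm_nonneg _) (by positivity)
    _ = K * K' * (1 + ‖γ‖) ^ (-(s.re - P.natDegree)) := by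
        rw [neg_sub, sub_eq_neg_add, Real.rpow_add (by positivity), Real.rpow_natCast]
        ring

theorem integrable_borderIntegrand (hΦ : IsMultiplicativeDistance Φ)
    (hP : (P.natDegree : ℝ) + 1 < s.re) : Integrable (borderIntegrand Φ s P) := by
  obtain ⟨K, -, h⟩ :=
    hΦ.exists_norm_rootWeight_mul_eval_le (zero_le_re_of_natDegree_add_one_lt hP) P
  have hdecay : Integrable fun x : ℝ => K * (1 + ‖x‖) ^ (-(s.re - P.natDegree)) :=
    (integrable_one_add_norm (by rw [Module.finrank_self, Nat.cast_one]; linarith)).const_mul K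
  refine hdecay.mono' ?_ (.of_forall fun x => by simpa [borderIntegrand] using h x)
  exact ((hΦ.continuous_rootWeight.mul P.continuous).comp
    Complex.continuous_ofReal).aestronglyMeasurable

theorem integrable_realFormIntegrand (hΦ : IsMultiplicativeDistance Φ)
    (hP : (P.natDegree : ℝ) + 1 < s.re) (hQ : (Q.natDegree : ℝ) + 1 < s.re) :
    Integrable (realFormIntegrand Φ s P Q) := by
  have hsign : Measurable fun z : ℝ × ℝ => (Real.sign (z.2 - z.1) : ℂ) :=
    Complex.measurable_ofReal.comp
      (measurable_real_sign.comp (measurable_snd.sub measurable_fst))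
  refine (((hΦ.integrable_borderIntegrand hP).mul_prod
    (hΦ.integrable_borderIntegrand hQ)).bdd_mul hsign.aestronglyMeasurable
      (.of_forall fun z => norm_real_sign_le_one _)).congr (.of_forall fun z => ?_)
  simp only [realFormIntegrand, borderIntegrand]
  ring

theorem continuous_rootWeight_mul_rootWeight_conj (hΦ : IsMultiplicativeDistance Φ) :
    Continuous fun β => rootWeight Φ s β * rootWeight Φ s (starRingEnd ℂ β) :=
  hΦ.continuous_rootWeight.mul (hΦ.continuous_rootWeight.comp Complex.continuous_conj)

theorem integrable_complexFormIntegrand (hΦ : IsMultiplicativeDistance Φ)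
    (hP : (P.natDegree : ℝ) + 1 < s.re) (hQ : (Q.natDegree : ℝ) + 1 < s.re) :
    Integrable (complexFormIntegrand Φ s P Q) := by
  have hs := zero_le_re_of_natDegree_add_one_lt hP
  obtain ⟨K, hK, hPK⟩ := hΦ.exists_norm_rootWeight_mul_eval_le hs P
  obtain ⟨K', hK', hQK⟩ := hΦ.exists_norm_rootWeight_mul_eval_le hs Q
  have hdecay : Integrable fun β : ℂ =>
      (K * K') * (1 + ‖β‖) ^ (-(s.re - P.natDegree + (s.re - Q.natDegree))) :=
    (integrable_one_add_norm (by
      rw [Complex.finrank_real_complex, Nat.cast_ofNat]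
      linarith)).const_mul _
  refine hdecay.mono' ?_ (.of_forall fun β => ?_)
  · exact (((hΦ.continuous_rootWeight_mul_rootWeight_conj.mul
      (P.continuous.comp Complex.continuous_conj)).mul Q.continuous).measurable.mul
        (Complex.measurable_ofReal.comp
          (measurable_real_sign.comp Complex.measurable_im))).aestronglyMeasurable
  · have hconj := hPK (starRingEnd ℂ β)
    rw [RCLike.norm_conj] at hconj
    calc ‖complexFormIntegrand Φ s P Q β‖
        = ‖rootWeight Φ s (starRingEnd ℂ β) * P.eval (starRingEnd ℂ β)‖ *
            ‖rootWeight Φ s β * Q.eval β‖ * ‖(Real.sign β.im : ℂ)‖ := by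
          rw [← norm_mul, ← norm_mul, complexFormIntegrand]
          congr 1
          ring
      _ ≤ K * (1 + ‖β‖) ^ (-(s.re - P.natDegree)) *
            (K' * (1 + ‖β‖) ^ (-(s.re - Q.natDegree))) * 1 :=
          mul_le_mul (mul_le_mul hconj (hQK β) (norm_nonneg _) (by positivity))
            (norm_real_sign_le_one _) (norm_nonneg _) (by positivity)
      _ = _ := by
          rw [neg_add, Real.rpow_add (by positivity)]
          ring

end IsMultiplicativeDistance

end RootWeight

section PointMoment

variable {Φ : ℂ[X] → ℝ} {s : ℂ} {n m : ℕ}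

/-- The weight `Φ(f)^{-s} f(z₁) ⋯ f(z_m)` of a polynomial `f`, for given points `zᵢ`. -/
def pointWeight (Φ : ℂ[X] → ℝ) (s : ℂ) (z : Fin m → ℂ) (f : ℂ[X]) : ℂ :=
  polyWeight Φ s f * ∏ i, f.eval (z i)

/-- The integral of `pointWeight` over the real monic polynomials of degree `n`. -/
def pointMoment (Φ : ℂ[X] → ℝ) (s : ℂ) (n : ℕ) (z : Fin m → ℂ) : ℂ :=
  ∫ b : Fin n → ℝ, pointWeight Φ s z ((monicPoly b).map (algebraMap ℝ ℂ))

/-- The point `(z₁, …, z_m, a, b)`. -/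
def snocTwo (z : Fin m → ℂ) (a b : ℂ) : Fin (m + 2) → ℂ :=
  Fin.snoc (Fin.snoc z a : Fin (m + 1) → ℂ) b

theorem prod_snocTwo {M : Type*} [CommMonoid M] (F : Fin (m + 2) → ℂ → M) (z : Fin m → ℂ)
    (a b : ℂ) : ∏ i, F i (snocTwo z a b i) =
      (∏ i : Fin m, F i.castSucc.castSucc (z i)) *
        (F (Fin.last m).castSucc a * F (Fin.last (m + 1)) b) := by
  rw [Fin.prod_univ_castSucc, Fin.prod_univ_castSucc]
  simp only [snocTwo, Fin.snoc_castSucc, Fin.snoc_last, mul_assoc]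

theorem pointWeight_snocTwo (z : Fin m → ℂ) (a b : ℂ) (f : ℂ[X]) :
    pointWeight Φ s (snocTwo z a b) f = pointWeight Φ s z f * (f.eval a * f.eval b) := by
  rw [pointWeight, prod_snocTwo fun _ x => f.eval x, ← mul_assoc, pointWeight]

theorem pointWeight_X_sub_C (z : Fin m → ℂ) (a : ℂ) :
    pointWeight Φ s z (X - C a) = rootWeight Φ s a * ∏ i, (z i - a) := by
  simp only [pointWeight, rootWeight_eq_polyWeight, eval_sub, eval_X, eval_C]

theorem exists_norm_eval_monicPoly_le (n : ℕ) (γ : ℂ) :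
    ∃ K : ℝ, 0 ≤ K ∧ ∀ b : Fin n → ℂ, ‖(monicPoly b).eval γ‖ ≤ K * (1 + ‖b‖) := by
  refine ⟨‖γ‖ ^ n + ∑ i : Fin n, ‖γ‖ ^ (i : ℕ), by positivity, fun b => ?_⟩
  simp only [monicPoly, lowPoly_apply, eval_add, eval_pow, eval_X, eval_finsetSum, eval_mul, eval_C]
  rw [add_mul, Finset.sum_mul]
  refine (norm_add_le _ _).trans (add_le_add ?_ ((norm_sum_le _ _).trans
    (Finset.sum_le_sum fun i _ => ?_)))
  · rw [norm_pow]
    exact le_mul_of_one_le_right (by positivity) (by linarith [norm_nonneg b])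
  · rw [norm_mul, norm_pow, mul_comm]
    gcongr
    linarith [norm_le_pi_norm b i]

theorem continuous_eval_monicPoly (γ : ℂ) :
    Continuous fun b : Fin n → ℂ => (monicPoly b).eval γ := by
  simp only [monicPoly, lowPoly_apply, eval_add, eval_pow, eval_X, eval_finsetSum, eval_mul, eval_C]
  fun_prop

namespace IsMultiplicativeDistance

theorem pointWeight_mul (hΦ : IsMultiplicativeDistance Φ) (z : Fin m → ℂ) (f g : ℂ[X]) :
    pointWeight Φ s z (f * g) = pointWeight Φ s z f * pointWeight Φ s z g := by
  simp only [pointWeight, hΦ.polyWeight_mul, eval_mul, Finset.prod_mul_distrib]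
  ring

theorem exists_norm_pointWeight_le (hΦ : IsMultiplicativeDistance Φ) (n : ℕ) (hs : 0 ≤ s.re)
    (z : Fin m → ℂ) : ∃ K : ℝ, ∀ b : Fin n → ℂ,
      ‖pointWeight Φ s z (monicPoly b)‖ ≤ K * (1 + ‖b‖) ^ (-(s.re - m)) := by
  obtain ⟨K, hK, hweight⟩ := hΦ.exists_norm_polyWeight_le n hs
  choose L _ heval using fun i => exists_norm_eval_monicPoly_le n (z i)
  refine ⟨K * ∏ i, L i, fun b => ?_⟩
  calc ‖pointWeight Φ s z (monicPoly b)‖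
      ≤ K * (1 + ‖b‖) ^ (-s.re) * ∏ i, (L i * (1 + ‖b‖)) := by
        rw [pointWeight, norm_mul, norm_prod]
        exact mul_le_mul (hweight b)
          (Finset.prod_le_prod (fun _ _ => norm_nonneg _) fun i _ => heval i b)
          (Finset.prod_nonneg fun _ _ => norm_nonneg _) (by positivity)
    _ = K * (∏ i, L i) * (1 + ‖b‖) ^ (-(s.re - m)) := by
        rw [Finset.prod_mul_distrib, Finset.prod_const, Finset.card_univ, Fintype.card_fin,
          neg_sub, sub_eq_neg_add, Real.rpow_add (by positivity), Real.rpow_natCast]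
        ring

theorem integrable_pointWeight (hΦ : IsMultiplicativeDistance Φ) (hs : (n + m : ℝ) < s.re)
    (z : Fin m → ℂ) : Integrable fun b : Fin n → ℝ =>
      pointWeight Φ s z ((monicPoly b).map (algebraMap ℝ ℂ)) := by
  have hs0 : 0 ≤ s.re := by linarith [n.cast_nonneg (α := ℝ), m.cast_nonneg (α := ℝ)]
  obtain ⟨K, h⟩ := hΦ.exists_norm_pointWeight_le n hs0 z
  have hdecay : Integrable fun b : Fin n → ℝ => K * (1 + ‖b‖) ^ (-(s.re - m)) :=
    (integrable_one_add_norm (by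
      rw [Module.finrank_fintype_fun_eq_card, Fintype.card_fin]
      linarith)).const_mul K
  have hcoe : Continuous fun b : Fin n → ℝ => (algebraMap ℝ ℂ) ∘ b := by
    simp only [Complex.coe_algebraMap]
    fun_prop
  have hcont : Continuous fun b : Fin n → ℂ => pointWeight Φ s z (monicPoly b) :=
    hΦ.continuous_polyWeight.mul (continuous_finsetProd _ fun i _ => continuous_eval_monicPoly _)
  simp only [map_monicPoly]
  refine hdecay.mono' (hcont.comp hcoe).aestronglyMeasurable (.of_forall fun b => ?_)
  have hnorm : ‖(algebraMap ℝ ℂ) ∘ b‖ = ‖b‖ := by simp [Pi.norm_def]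
  simpa only [hnorm] using h ((algebraMap ℝ ℂ) ∘ b)

end IsMultiplicativeDistance

end PointMoment

section Recursion

variable {Φ : ℂ[X] → ℝ} {s : ℂ} {n m : ℕ}

theorem measurePreserving_leftPart_rightPart :
    MeasurePreserving (fun z : Fin (m + n) → ℝ => (leftPart z, rightPart z)) volume volume :=
  (volume_measurePreserving_sumPiEquivProdPi fun _ : Fin m ⊕ Fin n => ℝ).comp
    (volume_measurePreserving_piCongrLeft (fun _ : Fin (m + n) => ℝ) finSumFinEquiv).symm

theorem measurableEmbedding_leftPart_rightPart :
    MeasurableEmbedding fun z : Fin (m + n) → ℝ => (leftPart z, rightPart z) :=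
  ((MeasurableEquiv.piCongrLeft (fun _ : Fin (m + n) => ℝ) finSumFinEquiv).symm.trans
    (MeasurableEquiv.sumPiEquivProdPi fun _ : Fin m ⊕ Fin n => ℝ)).measurableEmbedding

theorem integral_comp_leftPart_rightPart {α F : Type*} [MeasureSpace α] [NormedAddCommGroup F]
    [NormedSpace ℝ F] {e : (Fin m → ℝ) ≃ᵐ α} (he : MeasurePreserving e) {G : α → (Fin n → ℝ) → F}
    (hG : Integrable fun y : Fin (m + n) → ℝ => G (e (leftPart y)) (rightPart y)) :
    ∫ y : Fin (m + n) → ℝ, G (e (leftPart y)) (rightPart y) = ∫ a, ∫ b, G a b := by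
  have hG' : Integrable fun v : (Fin m → ℝ) × (Fin n → ℝ) => G (e v.1) v.2 :=
    (measurePreserving_leftPart_rightPart.integrable_comp_emb
      measurableEmbedding_leftPart_rightPart).1 hG
  rw [measurePreserving_leftPart_rightPart.integral_comp measurableEmbedding_leftPart_rightPart
    fun v => G (e v.1) v.2, ← he.integral_comp e.measurableEmbedding fun a => ∫ b, G a b]
  exact integral_prod _ hG'

namespace IsMultiplicativeDistance

theorem realJac_smul_pointWeight (hΦ : IsMultiplicativeDistance Φ) (z : Fin m → ℂ)
    (y : Fin (2 + n) → ℝ) {v : ℝ × ℝ} (hv : v = (leftPart y 0, leftPart y 1)) :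
    realJac y • pointWeight Φ s z ((monicPoly (paramMulMap realPair y)).map (algebraMap ℝ ℂ)) =
      (|v.2 - v.1| : ℝ) * (pointWeight Φ s z (X - C (v.1 : ℂ)) *
        pointWeight Φ s z (X - C (v.2 : ℂ))) *
        pointWeight Φ s (snocTwo z v.1 v.2) ((monicPoly (rightPart y)).map (algebraMap ℝ ℂ)) := by
  have heval : ∀ (p : ℝ[X]) (x : ℝ), (p.map (algebraMap ℝ ℂ)).eval (x : ℂ) = (p.eval x : ℝ) :=
    fun _ x => eval_map_apply (algebraMap ℝ ℂ) x
  rw [monicPoly_paramMulMap, monicPoly_realPair, Polynomial.map_mul, Polynomial.map_mul,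
    hΦ.pointWeight_mul, hΦ.pointWeight_mul, pointWeight_snocTwo, heval, heval, realJac, hv,
    Complex.real_smul, Polynomial.map_sub, Polynomial.map_sub, map_X, map_C, map_C]
  simp only [Complex.coe_algebraMap, Complex.ofReal_mul]
  ring

theorem conjJac_smul_pointWeight (hΦ : IsMultiplicativeDistance Φ) (z : Fin m → ℂ)
    (y : Fin (2 + n) → ℝ) {β : ℂ} (hβ : β = ⟨leftPart y 0, leftPart y 1⟩) :
    conjJac y • pointWeight Φ s z ((monicPoly (paramMulMap conjPair y)).map (algebraMap ℝ ℂ)) =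
      (4 * |β.im| : ℝ) * (pointWeight Φ s z (X - C (starRingEnd ℂ β)) *
        pointWeight Φ s z (X - C β)) *
        pointWeight Φ s (snocTwo z (starRingEnd ℂ β) β)
          ((monicPoly (rightPart y)).map (algebraMap ℝ ℂ)) := by
  have heval : ∀ p : ℝ[X], (p.map (algebraMap ℝ ℂ)).eval (starRingEnd ℂ β) *
      (p.map (algebraMap ℝ ℂ)).eval β = (‖aeval β p‖ ^ 2 : ℝ) := fun p => by
    rw [eval_map_algebraMap, eval_map_algebraMap, aeval_conj, Complex.conj_mul', Complex.ofReal_pow]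
  have him : β.im = leftPart y 1 := by rw [hβ]
  rw [monicPoly_paramMulMap, Polynomial.map_mul, map_monicPoly_conjPair, ← hβ,
    hΦ.pointWeight_mul, hΦ.pointWeight_mul, pointWeight_snocTwo, heval, conjJac, ← hβ, him,
    Complex.real_smul, Complex.ofReal_mul]
  ring

theorem integral_realJac_smul_pointWeight (hΦ : IsMultiplicativeDistance Φ)
    (hs : ((2 + n : ℕ) + m : ℝ) < s.re) (z : Fin m → ℂ) :
    ∫ y : Fin (2 + n) → ℝ, realJac y • pointWeight Φ s z
        ((monicPoly (paramMulMap realPair y)).map (algebraMap ℝ ℂ)) =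
      ∫ v : ℝ × ℝ, (|v.2 - v.1| : ℝ) * (pointWeight Φ s z (X - C (v.1 : ℂ)) *
        pointWeight Φ s z (X - C (v.2 : ℂ))) * pointMoment Φ s n (snocTwo z v.1 v.2) := by
  have hint := integrable_realJac_smul (hΦ.integrable_pointWeight hs z)
  let e := MeasurableEquiv.finTwoArrow (α := ℝ)
  have hjac := fun y : Fin (2 + n) → ℝ =>
    hΦ.realJac_smul_pointWeight (s := s) z y (v := e (leftPart y)) rfl
  simp only [hjac] at hint ⊢
  rw [integral_comp_leftPart_rightPart (volume_preserving_finTwoArrow ℝ)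
    (G := fun v b => (|v.2 - v.1| : ℝ) * (pointWeight Φ s z (X - C (v.1 : ℂ)) *
      pointWeight Φ s z (X - C (v.2 : ℂ))) *
        pointWeight Φ s (snocTwo z v.1 v.2) ((monicPoly b).map (algebraMap ℝ ℂ))) hint]
  simp only [integral_const_mul, pointMoment]

theorem integral_conjJac_smul_pointWeight (hΦ : IsMultiplicativeDistance Φ)
    (hs : ((2 + n : ℕ) + m : ℝ) < s.re) (z : Fin m → ℂ) :
    ∫ y : Fin (2 + n) → ℝ, conjJac y • pointWeight Φ s z
        ((monicPoly (paramMulMap conjPair y)).map (algebraMap ℝ ℂ)) =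
      ∫ β : ℂ, (4 * |β.im| : ℝ) * (pointWeight Φ s z (X - C (starRingEnd ℂ β)) *
        pointWeight Φ s z (X - C β)) * pointMoment Φ s n (snocTwo z (starRingEnd ℂ β) β) := by
  have hint := integrable_conjJac_smul (hΦ.integrable_pointWeight hs z)
  let e := Complex.measurableEquivPi.symm
  have hjac := fun y : Fin (2 + n) → ℝ =>
    hΦ.conjJac_smul_pointWeight (s := s) z y (β := e (leftPart y)) (by
      rw [Complex.measurableEquivPi_symm_apply, Complex.mk_eq_add_mul_I])
  simp only [hjac] at hint ⊢
  rw [integral_comp_leftPart_rightPart Complex.volume_preserving_equiv_pi.symm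
    (G := fun β b => (4 * |β.im| : ℝ) * (pointWeight Φ s z (X - C (starRingEnd ℂ β)) *
      pointWeight Φ s z (X - C β)) *
        pointWeight Φ s (snocTwo z (starRingEnd ℂ β) β) ((monicPoly b).map (algebraMap ℝ ℂ))) hint]
  simp only [integral_const_mul, pointMoment]

theorem pointMoment_two_add (hΦ : IsMultiplicativeDistance Φ)
    (hs : ((2 + n : ℕ) + m : ℝ) < s.re) (z : Fin m → ℂ) :
    ((2 * ((2 + n) / 2) : ℕ) : ℂ) * pointMoment Φ s (2 + n) z =
      (∫ v : ℝ × ℝ, (|v.2 - v.1| : ℝ) * (pointWeight Φ s z (X - C (v.1 : ℂ)) *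
        pointWeight Φ s z (X - C (v.2 : ℂ))) * pointMoment Φ s n (snocTwo z v.1 v.2)) +
      ∫ β : ℂ, (4 * |β.im| : ℝ) * (pointWeight Φ s z (X - C (starRingEnd ℂ β)) *
        pointWeight Φ s z (X - C β)) * pointMoment Φ s n (snocTwo z (starRingEnd ℂ β) β) := by
  rw [← hΦ.integral_realJac_smul_pointWeight hs, ← hΦ.integral_conjJac_smul_pointWeight hs,
    integral_realJac_smul_add_integral_conjJac_smul (hΦ.integrable_pointWeight hs z),
    Complex.real_smul, Complex.ofReal_natCast, pointMoment]

end IsMultiplicativeDistance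

end Recursion

section Vandermonde

variable {m : ℕ}

theorem det_vandermonde_snoc {R : Type*} [CommRing R] (z : Fin m → R) (a : R) :
    (Matrix.vandermonde (Fin.snoc z a : Fin (m + 1) → R)).det =
      (Matrix.vandermonde z).det * ∏ i, (a - z i) := by
  have hIoi : ∀ i : Fin m, Finset.Ioi i.castSucc =
      Finset.cons (Fin.last m) ((Finset.Ioi i).map Fin.castSuccEmb) (by simp) := fun i => by
    ext k
    cases k using Fin.lastCases <;> simp [Fin.castSucc_lt_last, Fin.le_last]
  simp only [Matrix.det_vandermonde, Fin.prod_univ_castSucc, hIoi, Finset.prod_cons,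
    Finset.prod_map, Fin.coe_castSuccEmb, Fin.snoc_castSucc, Fin.snoc_last, Finset.prod_mul_distrib]
  rw [← Fin.top_eq_last, Finset.Ioi_top, Finset.prod_empty, mul_one, mul_comm]

theorem det_vandermonde_snocTwo (z : Fin m → ℂ) (a b : ℂ) :
    (Matrix.vandermonde (snocTwo z a b)).det =
      (Matrix.vandermonde z).det * (∏ i, (a - z i)) * ((∏ i, (b - z i)) * (b - a)) := by
  rw [snocTwo, det_vandermonde_snoc, det_vandermonde_snoc, Fin.prod_univ_castSucc]
  simp only [Fin.snoc_castSucc, Fin.snoc_last]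

theorem det_vandermonde_eq_sum_perm {R : Type*} [CommRing R] {P : Fin m → R[X]}
    (hdeg : ∀ i, (P i).natDegree = i) (hmonic : ∀ i, (P i).Monic) (z : Fin m → R) :
    (Matrix.vandermonde z).det =
      ∑ τ : Equiv.Perm (Fin m), ((Equiv.Perm.sign τ : ℤ) : R) * ∏ i, (P (τ i)).eval (z i) := by
  rw [Matrix.det_eval_matrixOfPolynomials_eq_det_vandermonde z P hdeg hmonic,
    ← Matrix.det_transpose, Matrix.det_apply']
  rfl

end Vandermonde

section Induction

variable {Φ : ℂ[X] → ℝ} {s : ℂ} {n m : ℕ}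

theorem abs_eq_sign_mul (x : ℝ) : |x| = Real.sign x * x := by
  rcases lt_trichotomy x 0 with h | rfl | h
  · rw [abs_of_neg h, Real.sign_of_neg h, neg_one_mul]
  · rw [abs_zero, mul_zero]
  · rw [abs_of_pos h, Real.sign_of_pos h, one_mul]

theorem det_vandermonde_mul_pointWeight_mul (z : Fin m → ℂ) (a b : ℂ) :
    (Matrix.vandermonde z).det * ((b - a) *
        (pointWeight Φ s z (X - C a) * pointWeight Φ s z (X - C b))) =
      rootWeight Φ s a * rootWeight Φ s b * (Matrix.vandermonde (snocTwo z a b)).det := by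
  have hneg : ∀ x : ℂ, ∏ i, (x - z i) = (-1) ^ m * ∏ i, (z i - x) := fun x => by
    simp only [← neg_sub _ x, Finset.prod_neg, Finset.card_univ, Fintype.card_fin]
  have hsq : ((-1) ^ m * (-1) ^ m : ℂ) = 1 := by rw [← mul_pow, neg_one_mul, neg_neg, one_pow]
  rw [pointWeight_X_sub_C, pointWeight_X_sub_C, det_vandermonde_snocTwo, hneg, hneg]
  linear_combination -(rootWeight Φ s a * rootWeight Φ s b * (Matrix.vandermonde z).det *
    (∏ i, (z i - a)) * (∏ i, (z i - b)) * (b - a)) * hsq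

variable {ι : Type*} [Fintype ι] {c : ι → ℂ} {d : ℂ} {Q : ι → Fin (m + 2) → ℂ[X]}

theorem abs_sub_mul_pointMoment_eq_sum (h : ∀ z : Fin (m + 2) → ℂ,
      d * ((Matrix.vandermonde z).det * pointMoment Φ s n z) = ∑ t, c t * ∏ i, (Q t i).eval (z i))
    (z : Fin m → ℂ) (v : ℝ × ℝ) :
    d * (Matrix.vandermonde z).det * ((|v.2 - v.1| : ℝ) * (pointWeight Φ s z (X - C (v.1 : ℂ)) *
        pointWeight Φ s z (X - C (v.2 : ℂ))) * pointMoment Φ s n (snocTwo z v.1 v.2)) =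
      ∑ t, c t * (∏ i : Fin m, (Q t i.castSucc.castSucc).eval (z i)) *
        realFormIntegrand Φ s (Q t (Fin.last m).castSucc) (Q t (Fin.last (m + 1))) v := by
  have hmoment := h (snocTwo z v.1 v.2)
  simp only [fun t => prod_snocTwo fun i x => (Q t i).eval x] at hmoment
  calc _ = rootWeight Φ s v.1 * rootWeight Φ s v.2 * Real.sign (v.2 - v.1) *
        (d * ((Matrix.vandermonde (snocTwo z v.1 v.2)).det *
          pointMoment Φ s n (snocTwo z v.1 v.2))) := by
        rw [abs_eq_sign_mul]
        push_cast
        linear_combination (d * Real.sign (v.2 - v.1) * pointMoment Φ s n (snocTwo z v.1 v.2)) *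
          det_vandermonde_mul_pointWeight_mul (Φ := Φ) (s := s) z v.1 v.2
    _ = _ := by
        rw [hmoment, Finset.mul_sum]
        refine Finset.sum_congr rfl fun t _ => ?_
        rw [realFormIntegrand]
        ring

theorem abs_im_mul_pointMoment_eq_sum (h : ∀ z : Fin (m + 2) → ℂ,
      d * ((Matrix.vandermonde z).det * pointMoment Φ s n z) = ∑ t, c t * ∏ i, (Q t i).eval (z i))
    (z : Fin m → ℂ) (β : ℂ) :
    d * (Matrix.vandermonde z).det * ((4 * |β.im| : ℝ) *
        (pointWeight Φ s z (X - C (starRingEnd ℂ β)) * pointWeight Φ s z (X - C β)) *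
          pointMoment Φ s n (snocTwo z (starRingEnd ℂ β) β)) =
      ∑ t, c t * (∏ i : Fin m, (Q t i.castSucc.castSucc).eval (z i)) * (-2 * Complex.I *
        complexFormIntegrand Φ s (Q t (Fin.last m).castSucc) (Q t (Fin.last (m + 1))) β) := by
  have hmoment := h (snocTwo z (starRingEnd ℂ β) β)
  simp only [fun t => prod_snocTwo fun i x => (Q t i).eval x] at hmoment
  have habs : ((4 * |β.im| : ℝ) : ℂ) =
      -2 * Complex.I * Real.sign β.im * (β - starRingEnd ℂ β) := by
    rw [Complex.sub_conj, abs_eq_sign_mul]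
    push_cast
    linear_combination (4 * (Real.sign β.im : ℂ) * β.im) * Complex.I_sq
  calc _ = -2 * Complex.I * (rootWeight Φ s (starRingEnd ℂ β) * rootWeight Φ s β *
        Real.sign β.im) * (d * ((Matrix.vandermonde (snocTwo z (starRingEnd ℂ β) β)).det *
          pointMoment Φ s n (snocTwo z (starRingEnd ℂ β) β))) := by
        rw [habs]
        linear_combination (d * (-2 * Complex.I * Real.sign β.im) *
          pointMoment Φ s n (snocTwo z (starRingEnd ℂ β) β)) *
          det_vandermonde_mul_pointWeight_mul (Φ := Φ) (s := s) z (starRingEnd ℂ β) β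
    _ = _ := by
        rw [hmoment, Finset.mul_sum]
        refine Finset.sum_congr rfl fun t _ => ?_
        rw [complexFormIntegrand]
        ring

namespace IsMultiplicativeDistance

theorem det_vandermonde_mul_pointMoment_two_add (hΦ : IsMultiplicativeDistance Φ)
    (hs : ((2 + n : ℕ) + m : ℝ) < s.re) (hQ : ∀ t i, ((Q t i).natDegree : ℝ) + 1 < s.re)
    (h : ∀ z : Fin (m + 2) → ℂ,
      d * ((Matrix.vandermonde z).det * pointMoment Φ s n z) = ∑ t, c t * ∏ i, (Q t i).eval (z i))
    (z : Fin m → ℂ) :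
    ((2 * ((2 + n) / 2) : ℕ) : ℂ) * d * ((Matrix.vandermonde z).det * pointMoment Φ s (2 + n) z) =
      ∑ t, c t * skewForm Φ s (Q t (Fin.last m).castSucc) (Q t (Fin.last (m + 1))) *
        ∏ i : Fin m, (Q t i.castSucc.castSucc).eval (z i) := by
  rw [mul_assoc, ← mul_assoc d, mul_left_comm, hΦ.pointMoment_two_add hs, mul_add,
    ← integral_const_mul, ← integral_const_mul]
  simp only [abs_sub_mul_pointMoment_eq_sum h, abs_im_mul_pointMoment_eq_sum h]
  rw [integral_finsetSum _ fun t _ =>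
      (hΦ.integrable_realFormIntegrand (hQ t _) (hQ t _)).const_mul _,
    integral_finsetSum _ fun t _ =>
      ((hΦ.integrable_complexFormIntegrand (hQ t _) (hQ t _)).const_mul _).const_mul _,
    ← Finset.sum_add_distrib]
  refine Finset.sum_congr rfl fun t _ => ?_
  rw [integral_const_mul, integral_const_mul, integral_const_mul, skewForm, realForm, complexForm]
  ring

end IsMultiplicativeDistance

end Induction

section Expansion

variable {Φ : ℂ[X] → ℝ} {s : ℂ} {ι : Type*} [Fintype ι]

theorem pointMoment_one {m : ℕ} (z : Fin m → ℂ) : pointMoment Φ s 1 z =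
    ∫ x : ℝ, rootWeight Φ s x * ∏ i, (z i - x) := by
  rw [pointMoment, ← integral_neg_eq_self, ← (volume_preserving_funUnique (Fin 1) ℝ).integral_comp
    (MeasurableEquiv.funUnique (Fin 1) ℝ).measurableEmbedding]
  refine integral_congr_ae (.of_forall fun b => ?_)
  have hb : -b = fun _ => -(b 0) := funext fun i => by rw [Subsingleton.elim i 0, Pi.neg_apply]
  simp only [hb, monicPoly_const_neg, Polynomial.map_sub, map_X, map_C]
  exact pointWeight_X_sub_C z (b 0 : ℂ)

namespace IsMultiplicativeDistance

theorem pointMoment_zero (hΦ : IsMultiplicativeDistance Φ) {m : ℕ} (z : Fin m → ℂ) :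
    pointMoment Φ s 0 z = 1 := by
  have hone : ∀ b : Fin 0 → ℝ, (monicPoly b).map (algebraMap ℝ ℂ) = 1 := fun b => by
    simp [monicPoly, lowPoly_apply]
  simp only [pointMoment, hone]
  simp [pointWeight, hΦ.polyWeight_one, Measure.real, volume_pi, Measure.pi_empty_univ]

theorem det_vandermonde_mul_pointMoment_one (hΦ : IsMultiplicativeDistance Φ) {m : ℕ} {c : ι → ℂ}
    {Q : ι → Fin (m + 1) → ℂ[X]} (hQ : ∀ t, ((Q t (Fin.last m)).natDegree : ℝ) + 1 < s.re)
    (h : ∀ z : Fin (m + 1) → ℂ, (Matrix.vandermonde z).det = ∑ t, c t * ∏ i, (Q t i).eval (z i))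
    (z : Fin m → ℂ) :
    (Matrix.vandermonde z).det * pointMoment Φ s 1 z = (-1) ^ m *
      ∑ t, c t * (∫ x : ℝ, borderIntegrand Φ s (Q t (Fin.last m)) x) *
        ∏ i : Fin m, (Q t i.castSucc).eval (z i) := by
  have hpoint : ∀ x : ℝ, (Matrix.vandermonde z).det * (rootWeight Φ s x * ∏ i, (z i - x)) =
      (-1) ^ m * ∑ t, c t * (∏ i : Fin m, (Q t i.castSucc).eval (z i)) *
        borderIntegrand Φ s (Q t (Fin.last m)) x := fun x => by
    have hneg : ∏ i, (z i - x) = (-1) ^ m * ∏ i, ((x : ℂ) - z i) := by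
      simp only [← neg_sub (x : ℂ), Finset.prod_neg, Finset.card_univ, Fintype.card_fin]
    rw [hneg, mul_left_comm (rootWeight Φ s x), mul_left_comm, mul_left_comm _ (rootWeight Φ s x),
      ← det_vandermonde_snoc, h, Finset.mul_sum]
    congr 1
    refine Finset.sum_congr rfl fun t _ => ?_
    simp only [Fin.prod_univ_castSucc, Fin.snoc_castSucc, Fin.snoc_last, borderIntegrand]
    ring
  rw [pointMoment_one, ← integral_const_mul]
  simp only [hpoint]
  rw [integral_const_mul,
    integral_finsetSum _ fun t _ => (hΦ.integrable_borderIntegrand (hQ t)).const_mul _]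
  congr 1
  refine Finset.sum_congr rfl fun t _ => ?_
  rw [integral_const_mul, mul_right_comm]

-- The constant `2 ^ k * k !` is the product of the factors `2 ⌊n / 2⌋` over the degrees
-- `n = 2 i + r`, `1 ≤ i ≤ k`, that have been passed.
theorem two_pow_mul_factorial_mul_pointMoment (hΦ : IsMultiplicativeDistance Φ) {r : ℕ}
    (hr : r < 2) (j : ℕ) : ∀ {k : ℕ} {c : ι → ℂ} {Q : ι → Fin (2 * j) → ℂ[X]},
    ((2 * (k + j) + r : ℕ) : ℝ) < s.re → (∀ t i, ((Q t i).natDegree : ℝ) + 1 < s.re) →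
    (∀ z : Fin (2 * j) → ℂ, ((2 ^ k * k.factorial : ℕ) : ℂ) *
      ((Matrix.vandermonde z).det * pointMoment Φ s (2 * k + r) z) =
        ∑ t, c t * ∏ i, (Q t i).eval (z i)) →
    ((2 ^ (k + j) * (k + j).factorial : ℕ) : ℂ) * pointMoment Φ s (2 * (k + j) + r) ![] =
      ∑ t, c t * ∏ l : Fin j, skewForm Φ s (Q t ⟨2 * l, by omega⟩) (Q t ⟨2 * l + 1, by omega⟩) := by
  induction j with
  | zero =>
    intro k c Q _ _ h
    have hempty : IsEmpty (Fin (2 * 0)) := Fin.isEmpty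
    have h₀ := h ![]
    rw [Matrix.det_isEmpty, one_mul] at h₀
    simpa only [add_zero, Fintype.prod_empty] using h₀
  | succ j ih =>
    intro k c Q hs hQ h
    have hindex : 2 + (2 * k + r) = 2 * (k + 1) + r := by ring
    have hstep := hΦ.det_vandermonde_mul_pointMoment_two_add (m := 2 * j)
      (by refine lt_of_eq_of_lt ?_ hs; push_cast; ring) hQ h
    have hcoeff : 2 * ((2 + (2 * k + r)) / 2) * (2 ^ k * k.factorial) =
        2 ^ (k + 1) * (k + 1).factorial := by
      rw [show (2 + (2 * k + r)) / 2 = k + 1 by omega, Nat.factorial_succ]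
      ring
    rw [← Nat.cast_mul, hcoeff, hindex] at hstep
    have hrec := ih (by rwa [add_assoc, add_comm 1]) (fun t _ => hQ t _) hstep
    rw [add_assoc, add_comm 1 j] at hrec
    rw [hrec]
    refine Finset.sum_congr rfl fun t _ => ?_
    rw [Fin.prod_univ_castSucc, mul_assoc, mul_comm (skewForm Φ s _ _)]
    rfl

end IsMultiplicativeDistance

theorem IsCompleteMonicFamily.det_vandermonde_eq_sum_perm {N : ℕ} {P : Fin N → ℂ[X]}
    (hP : IsCompleteMonicFamily P) (z : Fin N → ℂ) :
    (Matrix.vandermonde z).det =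
      ∑ τ : Equiv.Perm (Fin N), ((Equiv.Perm.sign τ : ℤ) : ℂ) * ∏ i, (P (τ i)).eval (z i) :=
  _root_.det_vandermonde_eq_sum_perm (fun i => (hP i).2) (fun i => (hP i).1) z

theorem IsCompleteMonicFamily.natDegree_add_one_lt {N : ℕ} {P : Fin N → ℂ[X]}
    (hP : IsCompleteMonicFamily P) (hs : (N : ℝ) < s.re) (i : Fin N) :
    ((P i).natDegree : ℝ) + 1 < s.re := by
  rw [(hP i).2]
  exact lt_of_le_of_lt (by exact_mod_cast i.2) hs

namespace IsMultiplicativeDistance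

theorem pointMoment_two_mul (hΦ : IsMultiplicativeDistance Φ) {j : ℕ} {P : Fin (2 * j) → ℂ[X]}
    (hP : IsCompleteMonicFamily P) (hs : ((2 * j : ℕ) : ℝ) < s.re) :
    pointMoment Φ s (2 * j) ![] = 1 / (2 ^ j * (j.factorial : ℂ)) *
      ∑ τ : Equiv.Perm (Fin (2 * j)), ((Equiv.Perm.sign τ : ℤ) : ℂ) *
        ∏ l : Fin j, skewForm Φ s (P (τ ⟨2 * l, by omega⟩)) (P (τ ⟨2 * l + 1, by omega⟩)) := by
  have hiter := hΦ.two_pow_mul_factorial_mul_pointMoment two_pos j (k := 0)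
    (c := fun τ => ((Equiv.Perm.sign τ : ℤ) : ℂ))
    (Q := fun (τ : Equiv.Perm (Fin (2 * j))) i => P (τ i))
    (by simpa only [zero_add, add_zero] using hs) (fun τ i => hP.natDegree_add_one_lt hs (τ i))
    fun z => by
      rw [mul_zero, add_zero, hΦ.pointMoment_zero, mul_one, pow_zero, Nat.factorial_zero, mul_one,
        Nat.cast_one, one_mul, hP.det_vandermonde_eq_sum_perm]
  simp only [zero_add, add_zero] at hiter
  rw [← hiter]
  have := j.factorial_ne_zero
  push_cast
  field_simp

theorem pointMoment_two_mul_add_one (hΦ : IsMultiplicativeDistance Φ) {j : ℕ}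
    {P : Fin (2 * j + 1) → ℂ[X]} (hP : IsCompleteMonicFamily P)
    (hs : ((2 * j + 1 : ℕ) : ℝ) < s.re) :
    pointMoment Φ s (2 * j + 1) ![] = 1 / (2 ^ j * (j.factorial : ℂ)) *
      ∑ τ : Equiv.Perm (Fin (2 * j + 1)), ((Equiv.Perm.sign τ : ℤ) : ℂ) *
        ((∏ l : Fin j, skewForm Φ s (P (τ ⟨2 * l, by omega⟩)) (P (τ ⟨2 * l + 1, by omega⟩))) *
          ∫ x : ℝ, borderIntegrand Φ s (P (τ (Fin.last (2 * j)))) x) := by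
  have hone := hΦ.det_vandermonde_mul_pointMoment_one
    (Q := fun (τ : Equiv.Perm (Fin (2 * j + 1))) i => P (τ i))
    (fun τ => hP.natDegree_add_one_lt hs (τ (Fin.last (2 * j))))
    hP.det_vandermonde_eq_sum_perm
  have hiter := hΦ.two_pow_mul_factorial_mul_pointMoment one_lt_two j (k := 0)
    (c := fun τ => ((Equiv.Perm.sign τ : ℤ) : ℂ) *
      ∫ x : ℝ, borderIntegrand Φ s (P (τ (Fin.last (2 * j)))) x)
    (Q := fun (τ : Equiv.Perm (Fin (2 * j + 1))) i => P (τ i.castSucc))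
    (by simpa only [zero_add] using hs) (fun τ i => hP.natDegree_add_one_lt hs (τ i.castSucc))
    fun z => by
      rw [pow_zero, Nat.factorial_zero, mul_one, Nat.cast_one, one_mul, mul_zero, zero_add, hone,
        pow_mul, neg_one_sq, one_pow, one_mul]
  simp only [zero_add] at hiter
  rw [← Finset.sum_congr rfl fun τ _ => ?_, ← hiter]
  · have := j.factorial_ne_zero
    push_cast
    field_simp
  · rw [mul_assoc, mul_comm (∫ x : ℝ, _)]
    rfl

end IsMultiplicativeDistance

end Expansion

section PermSums

theorem sum_perm_eq_card_nsmul_sum_fixed {α M : Type*} [Fintype α] [DecidableEq α]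
    [AddCommMonoid M] {f : Equiv.Perm α → M} (a : α)
    (hf : ∀ p, ∃ h : Equiv.Perm α, h a = p ∧ ∀ τ, f (τ * h) = f τ) :
    ∑ τ, f τ = Fintype.card α • ∑ τ : Equiv.Perm α with τ a = a, f τ := by
  have hpreimage : ∀ p, ∑ τ : Equiv.Perm α with τ p = a, f τ =
      ∑ τ : Equiv.Perm α with τ a = a, f τ := fun p => by
    obtain ⟨h, rfl, hinv⟩ := hf p
    simp only [Finset.sum_filter]
    exact Fintype.sum_equiv (Equiv.mulRight h) _ _ fun τ => by
      rw [Equiv.coe_mulRight, hinv, Equiv.Perm.mul_apply]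
  rw [← Finset.sum_fiberwise _ fun τ : Equiv.Perm α => τ⁻¹ a]
  simp only [Equiv.Perm.inv_eq_iff_eq, eq_comm (a := a), hpreimage, Finset.sum_const,
    Finset.card_univ]

theorem sum_perm_fixing_last {n : ℕ} {M : Type*} [AddCommMonoid M]
    (f : Equiv.Perm (Fin (n + 1)) → M) :
    ∑ τ : Equiv.Perm (Fin (n + 1)) with τ (Fin.last n) = Fin.last n, f τ =
      ∑ σ : Equiv.Perm (Fin n), f (finSuccEquivLast.symm.permCongr σ.optionCongr) := by
  rw [Finset.sum_filter, ← (finSuccEquivLast (n := n)).symm.permCongr.sum_comp,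
    ← Equiv.Perm.decomposeOption.symm.sum_comp, Fintype.sum_prod_type, Fintype.sum_option]
  simp [← Equiv.Perm.one_def]

end PermSums

section Pfaffian

variable {J : ℕ}

/-- The position of the first row of the `i`-th pair in the definition of the Pfaffian. -/
def pairFst (i : Fin J) : Fin (2 * J) := ⟨2 * i, by omega⟩

/-- The position of the second row of the `i`-th pair in the definition of the Pfaffian. -/
def pairSnd (i : Fin J) : Fin (2 * J) := ⟨2 * i + 1, by omega⟩

theorem pairFst_injective : Function.Injective (pairFst (J := J)) := fun i k h => by
  simpa [pairFst, Fin.ext_iff] using h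

theorem pairSnd_injective : Function.Injective (pairSnd (J := J)) := fun i k h => by
  simpa [pairSnd, Fin.ext_iff] using h

theorem pairFst_ne_pairSnd (i k : Fin J) : pairFst i ≠ pairSnd k := fun h => by
  simp only [pairFst, pairSnd, Fin.mk.injEq] at h
  omega

theorem eq_pairFst_or_eq_pairSnd (p : Fin (2 * J)) : ∃ i, p = pairFst i ∨ p = pairSnd i :=
  ⟨⟨p / 2, by omega⟩, by simp only [pairFst, pairSnd, Fin.ext_iff]; omega⟩

/-- The summand of the permutation `τ` in `pfaffian U`. -/
def pfaffianTerm (U : Matrix (Fin (2 * J)) (Fin (2 * J)) ℂ) (τ : Equiv.Perm (Fin (2 * J))) : ℂ :=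
  ((Equiv.Perm.sign τ : ℤ) : ℂ) * ∏ i, U (τ (pairFst i)) (τ (pairSnd i))

theorem pfaffian_eq_sum_pfaffianTerm (U : Matrix (Fin (2 * J)) (Fin (2 * J)) ℂ) :
    pfaffian U = 1 / (2 ^ J * (J.factorial : ℂ)) * ∑ τ, pfaffianTerm U τ := rfl

theorem pfaffianTerm_mul_swap_pair {U : Matrix (Fin (2 * J)) (Fin (2 * J)) ℂ}
    (hU : U.transpose = -U) (i : Fin J) (τ : Equiv.Perm (Fin (2 * J))) :
    pfaffianTerm U (τ * Equiv.swap (pairFst i) (pairSnd i)) = pfaffianTerm U τ := by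
  have hfactor : ∀ k, U ((τ * Equiv.swap (pairFst i) (pairSnd i)) (pairFst k))
      ((τ * Equiv.swap (pairFst i) (pairSnd i)) (pairSnd k)) =
        (if k = i then -1 else 1) * U (τ (pairFst k)) (τ (pairSnd k)) := fun k => by
    simp only [Equiv.Perm.mul_apply]
    split_ifs with h
    · rw [h, Equiv.swap_apply_left, Equiv.swap_apply_right, neg_one_mul]
      exact congrFun₂ hU _ _
    · rw [Equiv.swap_apply_of_ne_of_ne (pairFst_injective.ne h) (pairFst_ne_pairSnd k i),
        Equiv.swap_apply_of_ne_of_ne (pairFst_ne_pairSnd i k).symm (pairSnd_injective.ne h),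
        one_mul]
  simp only [pfaffianTerm, hfactor, Finset.prod_mul_distrib, Finset.prod_ite_eq',
    Finset.mem_univ, if_true, Equiv.Perm.sign_mul, Equiv.Perm.sign_swap (pairFst_ne_pairSnd i i)]
  simp

theorem pfaffianTerm_mul_swap_mul_swap (U : Matrix (Fin (2 * J)) (Fin (2 * J)) ℂ) (i k : Fin J)
    (τ : Equiv.Perm (Fin (2 * J))) :
    pfaffianTerm U (τ * (Equiv.swap (pairFst i) (pairFst k) *
      Equiv.swap (pairSnd i) (pairSnd k))) = pfaffianTerm U τ := by
  have hfst : ∀ l, (Equiv.swap (pairFst i) (pairFst k) * Equiv.swap (pairSnd i) (pairSnd k))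
      (pairFst l) = pairFst (Equiv.swap i k l) := fun l => by
    rw [Equiv.Perm.mul_apply, Equiv.swap_apply_of_ne_of_ne (pairFst_ne_pairSnd l i)
      (pairFst_ne_pairSnd l k), pairFst_injective.swap_apply]
  have hsnd : ∀ l, (Equiv.swap (pairFst i) (pairFst k) * Equiv.swap (pairSnd i) (pairSnd k))
      (pairSnd l) = pairSnd (Equiv.swap i k l) := fun l => by
    rw [Equiv.Perm.mul_apply, pairSnd_injective.swap_apply, Equiv.swap_apply_of_ne_of_ne
      (pairFst_ne_pairSnd i _).symm (pairFst_ne_pairSnd k _).symm]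
  have hsign : Equiv.Perm.sign (Equiv.swap (pairFst i) (pairFst k)) =
      Equiv.Perm.sign (Equiv.swap (pairSnd i) (pairSnd k)) := by
    simp only [Equiv.Perm.sign_swap', pairFst_injective.eq_iff, pairSnd_injective.eq_iff]
  simp only [pfaffianTerm, Equiv.Perm.mul_apply τ, hfst, hsnd]
  rw [Equiv.Perm.sign_mul, Equiv.Perm.sign_mul, hsign, Int.units_mul_self, mul_one,
    Equiv.prod_comp (Equiv.swap i k) fun l => U (τ (pairFst l)) (τ (pairSnd l))]

theorem exists_perm_pfaffianTerm_mul_eq {U : Matrix (Fin (2 * J)) (Fin (2 * J)) ℂ}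
    (hU : U.transpose = -U) (k : Fin J) (p : Fin (2 * J)) :
    ∃ h : Equiv.Perm (Fin (2 * J)), h (pairSnd k) = p ∧
      ∀ τ, pfaffianTerm U (τ * h) = pfaffianTerm U τ := by
  obtain ⟨i, hp⟩ := eq_pairFst_or_eq_pairSnd p
  have hsnd : Equiv.swap (pairFst i) (pairFst k) (Equiv.swap (pairSnd i) (pairSnd k) (pairSnd k)) =
      pairSnd i := by
    rw [Equiv.swap_apply_right, Equiv.swap_apply_of_ne_of_ne (pairFst_ne_pairSnd i i).symm
      (pairFst_ne_pairSnd k i).symm]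
  rcases hp with rfl | rfl
  · refine ⟨Equiv.swap (pairFst i) (pairSnd i) * (Equiv.swap (pairFst i) (pairFst k) *
      Equiv.swap (pairSnd i) (pairSnd k)), ?_, fun τ => ?_⟩
    · rw [Equiv.Perm.mul_apply, Equiv.Perm.mul_apply, hsnd, Equiv.swap_apply_right]
    · rw [← mul_assoc, pfaffianTerm_mul_swap_mul_swap, pfaffianTerm_mul_swap_pair hU]
  · exact ⟨_, hsnd, pfaffianTerm_mul_swap_mul_swap U i k⟩

theorem pfaffianTerm_permCongr_optionCongr {j : ℕ}
    (U : Matrix (Fin (2 * (j + 1))) (Fin (2 * (j + 1))) ℂ) (σ : Equiv.Perm (Fin (2 * j + 1))) :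
    pfaffianTerm U (finSuccEquivLast.symm.permCongr σ.optionCongr) =
      ((Equiv.Perm.sign σ : ℤ) : ℂ) *
        ((∏ l : Fin j, U (σ ⟨2 * l, by omega⟩).castSucc (σ ⟨2 * l + 1, by omega⟩).castSucc) *
          U (σ (Fin.last (2 * j))).castSucc (Fin.last (2 * j + 1))) := by
  have hcast : ∀ k : Fin (2 * j + 1),
      finSuccEquivLast.symm.permCongr σ.optionCongr k.castSucc = (σ k).castSucc := fun k => by
    simp [Equiv.permCongr_apply]
  have hlast : finSuccEquivLast.symm.permCongr σ.optionCongr (Fin.last (2 * j + 1)) =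
      Fin.last (2 * j + 1) := by
    simp [Equiv.permCongr_apply]
  rw [pfaffianTerm, Equiv.Perm.sign_permCongr, Equiv.optionCongr_sign, Fin.prod_univ_castSucc,
    ← hcast, ← hlast]
  simp only [← hcast]
  rfl

theorem pfaffian_eq_sum_perm_last {j : ℕ} {U : Matrix (Fin (2 * (j + 1))) (Fin (2 * (j + 1))) ℂ}
    (hU : U.transpose = -U) : pfaffian U = 1 / (2 ^ j * (j.factorial : ℂ)) *
      ∑ σ : Equiv.Perm (Fin (2 * j + 1)), ((Equiv.Perm.sign σ : ℤ) : ℂ) *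
        ((∏ l : Fin j, U (σ ⟨2 * l, by omega⟩).castSucc (σ ⟨2 * l + 1, by omega⟩).castSucc) *
          U (σ (Fin.last (2 * j))).castSucc (Fin.last (2 * j + 1))) := by
  have hsum : ∑ τ, pfaffianTerm U τ = (2 * (j + 1)) • ∑ σ : Equiv.Perm (Fin (2 * j + 1)),
      pfaffianTerm U (finSuccEquivLast.symm.permCongr σ.optionCongr) := by
    rw [← sum_perm_fixing_last]
    exact (sum_perm_eq_card_nsmul_sum_fixed (Fin.last (2 * j + 1))
      (exists_perm_pfaffianTerm_mul_eq hU (Fin.last j))).trans (by rw [Fintype.card_fin]; rfl)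
  rw [pfaffian_eq_sum_pfaffianTerm, hsum]
  simp only [pfaffianTerm_permCongr_optionCongr, nsmul_eq_mul]
  rw [← mul_assoc, Nat.factorial_succ, pow_succ]
  congr 1
  have := j.factorial_ne_zero
  push_cast
  field_simp

end Pfaffian

section Antisymmetry

variable {Φ : ℂ[X] → ℝ} {s : ℂ}

theorem realForm_swap (P Q : ℂ[X]) : realForm Φ s P Q = -realForm Φ s Q P := by
  rw [realForm, realForm, ← integral_neg]
  refine ((Measure.measurePreserving_swap (μ := volume) (ν := volume)).integral_comp
    MeasurableEquiv.prodComm.measurableEmbedding (realFormIntegrand Φ s P Q)).symm.trans ?_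
  refine integral_congr_ae (.of_forall fun z => ?_)
  simp only [realFormIntegrand, Prod.fst_swap, Prod.snd_swap]
  rw [← neg_sub z.2 z.1, Real.sign_neg]
  push_cast
  ring

theorem complexForm_swap (P Q : ℂ[X]) : complexForm Φ s P Q = -complexForm Φ s Q P := by
  rw [complexForm, complexForm, ← mul_neg, ← integral_neg]
  congr 1
  refine (Complex.conjLIE.measurePreserving.integral_comp
    Complex.conjLIE.toHomeomorph.measurableEmbedding (complexFormIntegrand Φ s P Q)).symm.trans ?_
  refine integral_congr_ae (.of_forall fun β => ?_)
  simp only [complexFormIntegrand, Complex.conjLIE_apply, Complex.conj_conj, Complex.conj_im]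
  rw [Real.sign_neg]
  push_cast
  ring

theorem skewForm_swap (P Q : ℂ[X]) : skewForm Φ s P Q = -skewForm Φ s Q P := by
  rw [skewForm, realForm_swap, complexForm_swap, skewForm, neg_add]

variable {N : ℕ}

theorem skewMatrix_transpose (P : Fin N → ℂ[X]) :
    (skewMatrix Φ s P).transpose = -skewMatrix Φ s P := by
  ext a b
  simp only [skewMatrix, Matrix.transpose_apply, Matrix.of_apply, Matrix.neg_apply,
    min_comm (b : ℕ) a, and_comm (a := (b : ℕ) < N), ← neg_sub (b : ℤ) a, Left.sign_neg]
  split_ifs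
  · exact skewForm_swap _ _
  · simp
  · exact neg_zero.symm

variable {P : Fin N → ℂ[X]} {a b : Fin (2 * ((N + 1) / 2))}

theorem skewMatrix_apply_of_lt (ha : (a : ℕ) < N) (hb : (b : ℕ) < N) :
    skewMatrix Φ s P a b = skewForm Φ s (P ⟨a, ha⟩) (P ⟨b, hb⟩) :=
  dif_pos ⟨ha, hb⟩

theorem skewMatrix_apply_of_lt_of_eq (ha : (a : ℕ) < N) (hb : (b : ℕ) = N) :
    skewMatrix Φ s P a b = ∫ x : ℝ, borderIntegrand Φ s (P ⟨a, ha⟩) x := by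
  have hmin : min (a : ℕ) b = a := by omega
  have hsign : SignType.sign ((b : ℤ) - a) = 1 := sign_pos (by omega)
  rw [skewMatrix, Matrix.of_apply, dif_neg (by omega), dif_pos (by omega), hsign]
  simp only [hmin, SignType.coe_one, Int.cast_one, one_mul]

end Antisymmetry

section Conclusion

theorem pfaffian_submatrix_cast {J K : ℕ} (h : 2 * K = 2 * J)
    (U : Matrix (Fin (2 * J)) (Fin (2 * J)) ℂ) :
    pfaffian (J := K) (U.submatrix (Fin.cast h) (Fin.cast h)) = pfaffian U := by
  obtain rfl : K = J := by omega
  rw [show U.submatrix (Fin.cast h) (Fin.cast h) = U from rfl]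

variable {Φ : ℂ[X] → ℝ} {s : ℂ} {N : ℕ}

theorem monicRestriction_eq_monicPoly_rev (b : Fin N → ℂ) :
    monicRestriction Φ N b = Φ (monicPoly (b ∘ Fin.rev)) := by
  rw [monicRestriction, monicPoly, lowPoly_apply]
  refine congrArg (fun p => Φ (X ^ N + p)) (Fintype.sum_equiv Fin.revPerm _ _ fun i => ?_)
  rw [Fin.revPerm_apply, Function.comp_apply, Fin.rev_rev, Fin.val_rev]

theorem momentIntegrand_eq_pointWeight_comp_rev : momentIntegrand Φ N s =
    (fun b => pointWeight Φ s ![] ((monicPoly b).map (algebraMap ℝ ℂ))) ∘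
      MeasurableEquiv.piCongrLeft (fun _ : Fin N => ℝ) Fin.revPerm := by
  ext b
  have hrev : MeasurableEquiv.piCongrLeft (fun _ : Fin N => ℝ) Fin.revPerm b = b ∘ Fin.rev := by
    ext i
    obtain ⟨i, rfl⟩ := Fin.revPerm.surjective i
    rw [MeasurableEquiv.coe_piCongrLeft, Function.comp_apply, Fin.revPerm_apply, Fin.rev_rev]
    exact Equiv.piCongrLeft_apply_apply (P := fun _ => ℝ) Fin.revPerm b i
  rw [Function.comp_apply, hrev, pointWeight, Finset.univ_eq_empty, Finset.prod_empty, mul_one,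
    map_monicPoly, momentIntegrand, monicRestriction_eq_monicPoly_rev]
  rfl

theorem realMoment_eq_pointMoment : realMoment Φ N s = pointMoment Φ s N ![] := by
  rw [realMoment, momentIntegrand_eq_pointWeight_comp_rev]
  exact (volume_measurePreserving_piCongrLeft _ _).integral_comp
    (MeasurableEquiv.measurableEmbedding _)
    fun b => pointWeight Φ s ![] ((monicPoly b).map (algebraMap ℝ ℂ))

namespace IsMultiplicativeDistance

theorem integrable_momentIntegrand (hΦ : IsMultiplicativeDistance Φ)
    (hs : (N : ℝ) < s.re) : Integrable (momentIntegrand Φ N s) := by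
  rw [momentIntegrand_eq_pointWeight_comp_rev,
    (volume_measurePreserving_piCongrLeft _ _).integrable_comp_emb
      (MeasurableEquiv.measurableEmbedding _)]
  exact hΦ.integrable_pointWeight (by simpa using hs) ![]

theorem realMoment_eq_pfaffian_of_even (hΦ : IsMultiplicativeDistance Φ) {P : Fin N → ℂ[X]}
    (hP : IsCompleteMonicFamily P) (hs : (N : ℝ) < s.re) (hN : Even N) :
    realMoment Φ N s = pfaffian (skewMatrix Φ s P) := by
  obtain ⟨j, rfl⟩ := even_iff_exists_two_mul.1 hN
  have hsize : 2 * j = 2 * ((2 * j + 1) / 2) := by omega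
  have hform : ∀ a b : Fin (2 * j),
      (skewMatrix Φ s P).submatrix (Fin.cast hsize) (Fin.cast hsize) a b =
        skewForm Φ s (P a) (P b) := fun a b => skewMatrix_apply_of_lt a.2 b.2
  rw [realMoment_eq_pointMoment, hΦ.pointMoment_two_mul hP hs, ← pfaffian_submatrix_cast hsize,
    pfaffian]
  simp only [hform]

theorem realMoment_eq_pfaffian_of_odd (hΦ : IsMultiplicativeDistance Φ) {P : Fin N → ℂ[X]}
    (hP : IsCompleteMonicFamily P) (hs : (N : ℝ) < s.re) (hN : Odd N) :
    realMoment Φ N s = pfaffian (skewMatrix Φ s P) := by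
  obtain ⟨j, rfl⟩ := hN
  have hsize : 2 * (j + 1) = 2 * ((2 * j + 1 + 1) / 2) := by omega
  have hskew : ((skewMatrix Φ s P).submatrix (Fin.cast hsize) (Fin.cast hsize)).transpose =
      -(skewMatrix Φ s P).submatrix (Fin.cast hsize) (Fin.cast hsize) := by
    rw [Matrix.transpose_submatrix, skewMatrix_transpose, Matrix.submatrix_neg]
    rfl
  have hform : ∀ a b : Fin (2 * j + 1),
      (skewMatrix Φ s P).submatrix (Fin.cast hsize) (Fin.cast hsize) a.castSucc b.castSucc =
        skewForm Φ s (P a) (P b) := fun a b => skewMatrix_apply_of_lt a.2 b.2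
  have hborder : ∀ a : Fin (2 * j + 1),
      (skewMatrix Φ s P).submatrix (Fin.cast hsize) (Fin.cast hsize) a.castSucc
        (Fin.last (2 * j + 1)) = ∫ x : ℝ, borderIntegrand Φ s (P a) x :=
    fun a => skewMatrix_apply_of_lt_of_eq a.2 rfl
  rw [realMoment_eq_pointMoment, hΦ.pointMoment_two_mul_add_one hP hs,
    ← pfaffian_submatrix_cast hsize, pfaffian_eq_sum_perm_last hskew]
  simp only [hform, hborder]

theorem realMoment_eq_pfaffian (hΦ : IsMultiplicativeDistance Φ) {P : Fin N → ℂ[X]}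
    (hP : IsCompleteMonicFamily P) (hs : (N : ℝ) < s.re) :
    realMoment Φ N s = pfaffian (skewMatrix Φ s P) :=
  N.even_or_odd.elim (hΦ.realMoment_eq_pfaffian_of_even hP hs)
    (hΦ.realMoment_eq_pfaffian_of_odd hP hs)

end IsMultiplicativeDistance

end Conclusion

end

/-- The conclusion includes the absolute convergence of every integral that enters the formula, and
the antisymmetry of the matrix. -/
theorem theorem5 (Φ : ℂ[X] → ℝ) (hΦ : IsMultiplicativeDistance Φ) (N : ℕ) (s : ℂ)
    (hs : (N : ℝ) < s.re) (P : Fin N → ℂ[X]) (hP : IsCompleteMonicFamily P) :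
    Integrable (momentIntegrand Φ N s) ∧
    (∀ j k, Integrable (realFormIntegrand Φ s (P j) (P k))) ∧
    (∀ j k, Integrable (complexFormIntegrand Φ s (P j) (P k))) ∧
    (∀ j, Integrable (borderIntegrand Φ s (P j))) ∧
    (skewMatrix Φ s P).transpose = -skewMatrix Φ s P ∧
    realMoment Φ N s = pfaffian (skewMatrix Φ s P) := by
  have hdeg := hP.natDegree_add_one_lt hs
  exact ⟨hΦ.integrable_momentIntegrand hs,
    fun j k => hΦ.integrable_realFormIntegrand (hdeg j) (hdeg k),
    fun j k => hΦ.integrable_complexFormIntegrand (hdeg j) (hdeg k),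
    fun j => hΦ.integrable_borderIntegrand (hdeg j),
    skewMatrix_transpose P,
    hΦ.realMoment_eq_pfaffian hP hs⟩
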